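/- Setting. Let $A\subseteq\mathbb R$ be a nonempty closed convex set (for instance $A=\mathbb R$), $b:A\times\mathbb R\to\mathbb R$ and $f:\mathbb R\times A\times\mathbb R\to\mathbb R$ functions, and $\mu_0$ a probability measure on $\mathbb R$ with mean zero and finite second moment. Let $I=[0,1]$ with Lebesgue measure. Let $\mathcal K$ be the set of probability measures on $\mathbb R\times\mathbb R$ with first marginal $\mu_0$ and finite second moment, and put $$\tilde{\mathcal J}(\alpha,\nu)=\int f(b(\alpha,z)+\xi,\alpha,z)\,\nu(d\xi,dz),\qquad \mathcal J(\alpha,z)=\int f(b(\alpha,z)+\xi,\alpha,z)\,\mu_0(d\xi),$$ the integrals being assumed to exist for all $\alpha\in A$, $\nu\in\mathcal K$, $z\in\mathbb R$. Assume that there are constants $c_\alpha,c_z\ge 0$, $c_0,\ell_c>0$ and $\ell_J,\tilde\ell_J$ such that for all $\alpha,\alpha'\in A$, $z,z'\in\mathbb R$ and $\nu,\nu'\in\mathcal K$: * $|b(\alpha,z)-b(\alpha',z')|^2\le c_\alpha|\alpha-\alpha'|^2+c_z|z-z'|^2$ and $|b(\alpha,z)|\le c_0$; * $|\tilde{\mathcal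 J}(\alpha,\nu')-\tilde{\mathcal J}(\alpha,\nu)|\le\tilde\ell_J\,W_2(\nu,\nu')$, where $W_2$ is the 2-Wasserstein distance; * $\mathcal J(\cdot,z)$ is continuously differentiable on $A$ and strongly convex with constant $\ell_c$, i.e. $\mathcal J(\epsilon\alpha+(1-\epsilon)\alpha',z)\le\epsilon\mathcal J(\alpha,z)+(1-\epsilon)\mathcal J(\alpha',z)-\frac{\ell_c}{2}\epsilon(1-\epsilon)|\alpha-\alpha'|^2$ for $\epsilon\in[0,1]$, and $|\partial_\alpha\mathcal J(\alpha,z')-\partial_\alpha\mathcal J(\alpha,z)|\le\ell_J|z'-z|$. $N$-player game. Let $W$ be a symmetric real $N\times N$ matrix and $\xi_1,\dots,\xi_N$ i.i.d. random variables with law $\mu_0$ on a probability space $\Omega$. For $\boldsymbol\alpha\in A^N$ let $\mathbf z=\mathbf Z_N\boldsymbol\alpha\in L^2(\Omega;\mathbb R^N)$ be the solution of $z_i=\frac1N\sum_{j=1}^N W_{i,j}\,(b(\alpha_j,z_j)+\xi_j)$, $i=1,\dots,N$ (it exists and is unique if $c_z\frac1{N^2}\sum_{i,j}W_{i,j}^2<1$).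 The cost of player $i$ is $J_i(\boldsymbol\alpha)=\mathbb E[f(b(\alpha_i,z_i)+\xi_i,\alpha_i,z_i)]$, and $\boldsymbol\alpha\in A^N$ is a Nash equilibrium if no player $i$ can lower $J_i$ by replacing $\alpha_i$ alone by another action in $A$. Graphon game. A graphon is a symmetric, Borel measurable, square-integrable $w:I\times I\to\mathbb R$; $\|w\|_2$ is its $L^2(I\times I)$ norm, $\mathbf W g=\int_I w(\cdot,y)g(y)\,dy$ its operator on $L^2(I)$, and $\|\mathbf W\|$ the operator norm. When $\sqrt{c_z}\|\mathbf W\|<1$, for $\boldsymbol\alpha\in L^2(I)$ with values in $A$ let $\mathbf z=\mathbf Z\boldsymbol\alpha\in L^2(I)$ be the unique solution of $z_x=\int_I w(x,y)\,b(\alpha_y,z_y)\,dy$ for a.e. $x$. A Nash equilibrium of the graphon game with $w$ is an $\hat{\boldsymbol\alpha}\in L^2(I)$ with values in $A$ such that, for a.e. $x\in I$ and all $\beta\in A$, $\mathcal J(\hat\alpha_x,(\mathbf Z\hat{\boldsymbol\alpha})_x)\le\mathcal J(\beta,(\mathbf Z\hat{\boldsymbol\alpha})_x)$. Distances. Let $\mathcal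 S_I$ be the set of invertible bi-measurable Lebesgue-measure-preserving maps $I\to I$. Put $\|w\|_\square=\sup_{S,T\in\mathcal B(I)}|\int_{S\times T}w|$, $\delta_\square(w,w')=\inf_{\varphi\in\mathcal S_I}\|w(\varphi(\cdot),\varphi(\cdot))-w'\|_\square$ and $d_{\mathcal S}(\boldsymbol\alpha,\boldsymbol\alpha')=\inf_{\varphi\in\mathcal S_I}\|\boldsymbol\alpha\circ\varphi-\boldsymbol\alpha'\|_{L^2(I)}$. For $\boldsymbol\alpha\in A^N$ let $\psi^N(\boldsymbol\alpha)$ be the step function equal to $\alpha_i$ on $[\frac{i-1}N,\frac iN)$, and let $\Psi^N(W)$ be the step graphon equal to $W_{i,j}$ on $[\frac{i-1}N,\frac iN)\times[\frac{j-1}N,\frac jN)$. Theorem. Let $(W^N)_{N\ge1}$ be symmetric matrices, $W^N\in\mathbb R^{N\times N}$, such that for all sufficiently large $N$ (in particular, if for every $N\ge 1$) the $N$-player game with matrix $W^N$ has a unique Nash equilibrium $\boldsymbol\alpha^{N,*}$. Let $w^N=\Psi^N(W^N)$ with operator $\mathbf W^N$, and suppose there is a graphon $w$ with operator $\mathbf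 W$ such that $\delta_\square(w^N,w)\to0$, $\|w^N\|_2\to\|w\|_2$ and $\|\mathbf W^N\|\to\|\mathbf W\|$ as $N\to\infty$, and $$\sqrt{2c_z}\,\|w\|_2<1,\qquad\sqrt{c_z}\,\|\mathbf W\|<1,\qquad\frac{\ell_J}{\ell_c}\cdot\frac{\sqrt{c_\alpha}\,\|\mathbf W\|}{1-\sqrt{c_z}\,\|\mathbf W\|}<1.$$ Then the graphon game with $w$ has a unique Nash equilibrium $\hat{\boldsymbol\alpha}$, and $$\lim_{N\to\infty}d_{\mathcal S}\bigl(\psi^N(\boldsymbol\alpha^{N,*}),\hat{\boldsymbol\alpha}\bigr)=0.$$ -/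

import Mathlib

open MeasureTheory ProbabilityTheory Filter Topology unitInterval

noncomputable section

namespace GraphonGame

/-! ### Costs, and the assumptions on the data of the game

`A ⊆ ℝ` is the set of actions, `b (α, z)` the drift, `f (x, α, z)` the running cost and `μ₀` the
common law of the idiosyncratic shocks. The state of a player is `b α z + ξ`. The values of `b` and
`f` at actions outside `A` are irrelevant. -/

/-- The squared Lipschitz condition on `b` over `A × ℝ`. -/
def LipschitzDrift (A : Set ℝ) (b : ℝ → ℝ → ℝ) (cα cz : ℝ) : Prop :=
  0 ≤ cα ∧ 0 ≤ cz ∧ ∀ α ∈ A, ∀ α' ∈ A, ∀ z z' : ℝ,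
    |b α z - b α' z'| ^ 2 ≤ cα * |α - α'| ^ 2 + cz * |z - z'| ^ 2

/-- The law of the shocks is centred and has a finite second moment. -/
def CenteredSquareIntegrable (μ₀ : Measure ℝ) : Prop :=
  MemLp id 2 μ₀ ∧ ∫ ξ, ξ ∂μ₀ = 0

/-- `b` is bounded by `c₀` on `A × ℝ`. -/
def BoundedDrift (A : Set ℝ) (b : ℝ → ℝ → ℝ) (c₀ : ℝ) : Prop :=
  0 < c₀ ∧ ∀ α ∈ A, ∀ z : ℝ, |b α z| ≤ c₀

/-- The probability measures on `ℝ × ℝ` (pairs `(ξ, z)`) with first marginal `μ₀` and finite second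
moment; the first coordinate has a second moment because `μ₀` has one. -/
def ShockAggregateLaws (μ₀ : Measure ℝ) : Set (Measure (ℝ × ℝ)) :=
  {ν | IsProbabilityMeasure ν ∧ ν.map Prod.fst = μ₀ ∧ MemLp Prod.snd 2 ν}

/-- The cost `𝒥̃(α, ν)` of the action `α` when the pair (shock, aggregate) has law `ν`. -/
def costLaw (b : ℝ → ℝ → ℝ) (f : ℝ → ℝ → ℝ → ℝ) (α : ℝ) (ν : Measure (ℝ × ℝ)) : ℝ :=
  ∫ p, f (b α p.2 + p.1) α p.2 ∂ν

/-- The cost `𝒥(α, z)` of the action `α` when the aggregate is the deterministic number `z`. -/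
def cost (b : ℝ → ℝ → ℝ) (f : ℝ → ℝ → ℝ → ℝ) (μ₀ : Measure ℝ) (α z : ℝ) : ℝ :=
  ∫ ξ, f (b α z + ξ) α z ∂μ₀

/-- The expectations that define the costs exist. -/
def CostIntegrable (A : Set ℝ) (b : ℝ → ℝ → ℝ) (f : ℝ → ℝ → ℝ → ℝ) (μ₀ : Measure ℝ) : Prop :=
  ∀ α ∈ A, ∀ ν ∈ ShockAggregateLaws μ₀,
    Integrable (fun p : ℝ × ℝ => f (b α p.2 + p.1) α p.2) ν

/-- The `2`-Wasserstein distance on the Euclidean plane, through couplings. -/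
def wasserstein2 (ν ν' : Measure (ℝ × ℝ)) : ℝ :=
  Real.sqrt (ENNReal.toReal
    (⨅ π ∈ {π : Measure ((ℝ × ℝ) × (ℝ × ℝ)) | π.map Prod.fst = ν ∧ π.map Prod.snd = ν'},
      ∫⁻ q, ENNReal.ofReal ((q.1.1 - q.2.1) ^ 2 + (q.1.2 - q.2.2) ^ 2) ∂π))

/-- `𝒥̃(α, ·)` is Lipschitz for the `2`-Wasserstein distance, uniformly in `α ∈ A`. -/
def CostLawLipschitz (A : Set ℝ) (b : ℝ → ℝ → ℝ) (f : ℝ → ℝ → ℝ → ℝ) (μ₀ : Measure ℝ)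
    (lJt : ℝ) : Prop :=
  ∀ α ∈ A, ∀ ν ∈ ShockAggregateLaws μ₀, ∀ ν' ∈ ShockAggregateLaws μ₀,
    |costLaw b f α ν' - costLaw b f α ν| ≤ lJt * wasserstein2 ν ν'

/-- `𝒥(·, z)` is `C¹` and `ℓ_c`-strongly convex on `A`, and `∂_α 𝒥(α, ·)` is `ℓ_J`-Lipschitz. -/
def CostRegular (A : Set ℝ) (b : ℝ → ℝ → ℝ) (f : ℝ → ℝ → ℝ → ℝ) (μ₀ : Measure ℝ)
    (lc lJ : ℝ) : Prop :=
  0 < lc ∧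
  (∀ z : ℝ, ContDiffOn ℝ 1 (fun α => cost b f μ₀ α z) A ∧
    StrongConvexOn A lc (fun α => cost b f μ₀ α z)) ∧
  ∀ α ∈ A, ∀ z z' : ℝ,
    |derivWithin (fun a => cost b f μ₀ a z') A α - derivWithin (fun a => cost b f μ₀ a z) A α|
      ≤ lJ * |z' - z|

/-! ### The `N`-player game -/

section FinitePlayer

variable {N : ℕ} {Ω : Type*} [MeasurableSpace Ω]

/-- `z ∈ L²(Ω; ℝ^N)` is a family of aggregates for the profile `α`:
`z_i = (1/N) ∑_j W_{ij} (b(α_j, z_j) + ξ_j)` in `L²`. -/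
def IsAggregate (b : ℝ → ℝ → ℝ) (P : Measure Ω) (ξ : Fin N → Ω → ℝ)
    (W : Matrix (Fin N) (Fin N) ℝ) (α : Fin N → ℝ) (z : Fin N → Lp ℝ 2 P) : Prop :=
  ∀ i, (z i : Ω → ℝ) =ᵐ[P]
    fun ω => (1 / (N : ℝ)) * ∑ j, W i j * (b (α j) (z j ω) + ξ j ω)

/-- The aggregate operator `𝐙_N`: the element of `L²(Ω; ℝ^N)` that is a family of aggregates for `α`.
It exists and is unique whenever `√c_z ‖W‖_F < 1`. -/
def aggregate (b : ℝ → ℝ → ℝ) (P : Measure Ω) (ξ : Fin N → Ω → ℝ)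
    (W : Matrix (Fin N) (Fin N) ℝ) (α : Fin N → ℝ) : Fin N → Lp ℝ 2 P :=
  Classical.epsilon (IsAggregate b P ξ W α)

/-- The cost `J_i(α)` of player `i`. -/
def playerCost (b : ℝ → ℝ → ℝ) (f : ℝ → ℝ → ℝ → ℝ) (P : Measure Ω) (ξ : Fin N → Ω → ℝ)
    (W : Matrix (Fin N) (Fin N) ℝ) (i : Fin N) (α : Fin N → ℝ) : ℝ :=
  ∫ ω, f (b (α i) (aggregate b P ξ W α i ω) + ξ i ω) (α i) (aggregate b P ξ W α i ω) ∂P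

/-- Nash equilibria of the `N`-player game with interaction matrix `W`. -/
def IsNash (A : Set ℝ) (b : ℝ → ℝ → ℝ) (f : ℝ → ℝ → ℝ → ℝ) (P : Measure Ω)
    (ξ : Fin N → Ω → ℝ) (W : Matrix (Fin N) (Fin N) ℝ) (α : Fin N → ℝ) : Prop :=
  (∀ i, α i ∈ A) ∧ ∀ i, ∀ β ∈ A,
    playerCost b f P ξ W i α ≤ playerCost b f P ξ W i (Function.update α i β)

end FinitePlayer

/-! ### Graphons -/

/-- A graphon: a symmetric, measurable, square-integrable function on the unit square. -/
structure IsGraphon (w : I → I → ℝ) : Prop where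
  symm : ∀ x y, w x y = w y x
  measurable : Measurable (fun p : I × I => w p.1 p.2)
  integrable_sq : Integrable (fun p : I × I => w p.1 p.2 ^ 2)

/-- `‖w‖₂`. -/
def graphonNorm (w : I → I → ℝ) : ℝ :=
  Real.sqrt (∫ p : I × I, w p.1 p.2 ^ 2)

/-- The integral operator `[𝐖 g]_x = ∫ w(x, y) g(y) dy`. -/
def graphonOp (w : I → I → ℝ) (g : I → ℝ) (x : I) : ℝ :=
  ∫ y, w x y * g y

/-- The `L²` norm of a function on `I`. -/
def normL2 (g : I → ℝ) : ℝ := (eLpNorm g 2 volume).toReal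

/-- The operator norm of `𝐖` on `L²(I)`. -/
def graphonOpNorm (w : I → I → ℝ) : ℝ :=
  sSup {r | ∃ φ : Lp ℝ 2 (volume : Measure I), ‖φ‖ = 1 ∧ r = normL2 (graphonOp w φ)}

/-- The cut norm. -/
def cutNorm (w : I → I → ℝ) : ℝ :=
  sSup {r | ∃ S T : Set I, MeasurableSet S ∧ MeasurableSet T ∧
    r = |∫ p in S ×ˢ T, w p.1 p.2|}

/-- The invertible bi-measurable maps of `I` that preserve Lebesgue measure. -/
def MPEquiv : Type := {φ : I ≃ᵐ I // MeasurePreserving φ volume volume}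

/-- The cut distance `δ_□(w, w') = inf_φ ‖w^φ - w'‖_□`. -/
def cutDist (w w' : I → I → ℝ) : ℝ :=
  ⨅ φ : MPEquiv, cutNorm (fun x y => w (φ.1 x) (φ.1 y) - w' x y)

/-- The permutation-invariant `L²` distance `d_S(α, α') = inf_φ ‖α^φ - α'‖`. -/
def distS (α α' : I → ℝ) : ℝ :=
  ⨅ φ : MPEquiv, normL2 (fun x => α (φ.1 x) - α' x)

/-- The step function `ψ^N(α)`: with players numbered from `0`, its value on `[i/N, (i+1)/N)` is
`α_i`. The value at the point `1` is `0`. -/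
def stepFun {N : ℕ} (α : Fin N → ℝ) (x : I) : ℝ :=
  if h : ⌊(N : ℝ) * (x : ℝ)⌋₊ < N then α ⟨⌊(N : ℝ) * (x : ℝ)⌋₊, h⟩ else 0

/-- The step graphon `Ψ^N(W)`, equal to `W_{ij}` on `[i/N, (i+1)/N) × [j/N, (j+1)/N)`. -/
def stepGraphon {N : ℕ} (W : Matrix (Fin N) (Fin N) ℝ) (x y : I) : ℝ :=
  stepFun (fun i => stepFun (W i) y) x

/-! ### The graphon game -/

/-- The admissible strategy profiles: the elements of `L²(I)` with values in `A`. -/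
def Admissible (A : Set ℝ) : Set (Lp ℝ 2 (volume : Measure I)) :=
  {α | ∀ᵐ x, α x ∈ A}

/-- `z_x = ∫ w(x, y) b(α_y, z_y) dy` for almost every `x`. -/
def IsGraphonAggregate (b : ℝ → ℝ → ℝ) (w : I → I → ℝ)
    (α z : Lp ℝ 2 (volume : Measure I)) : Prop :=
  ∀ᵐ x, z x = ∫ y, w x y * b (α y) (z y)

/-- The aggregate operator `𝐙`: the solution `z ∈ L²(I)` of the fixed point equation. It exists and
is unique whenever `√c_z ‖𝐖‖ < 1`. -/
def graphonAggregate (b : ℝ → ℝ → ℝ) (w : I → I → ℝ)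
    (α : Lp ℝ 2 (volume : Measure I)) : Lp ℝ 2 (volume : Measure I) :=
  Classical.epsilon (IsGraphonAggregate b w α)

/-- The best responses to the profile `α` in the graphon game. The cost of player `x` is
`J_x(β, α) = 𝔼[f(b(β, z_x) + ξ_x, β, z_x)] = 𝒥(β, z_x)` with `z = 𝐙α`, since `ξ_x` has law `μ₀`. -/
def bestResponses (A : Set ℝ) (b : ℝ → ℝ → ℝ) (f : ℝ → ℝ → ℝ → ℝ) (μ₀ : Measure ℝ)
    (w : I → I → ℝ) (α : Lp ℝ 2 (volume : Measure I)) : Set (Lp ℝ 2 (volume : Measure I)) :=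
  {α' | α' ∈ Admissible A ∧ ∀ᵐ x, ∀ β ∈ A,
    cost b f μ₀ (α' x) (graphonAggregate b w α x) ≤ cost b f μ₀ β (graphonAggregate b w α x)}

/-- Nash equilibria of the graphon game: admissible fixed points of the best response map. -/
def IsGraphonNash (A : Set ℝ) (b : ℝ → ℝ → ℝ) (f : ℝ → ℝ → ℝ → ℝ) (μ₀ : Measure ℝ)
    (w : I → I → ℝ) (α : Lp ℝ 2 (volume : Measure I)) : Prop :=
  α ∈ Admissible A ∧ α ∈ bestResponses A b f μ₀ w α

end GraphonGame

end

/-! Strong convexity makes the best reply `a(z)` to a deterministic aggregate `z` unique and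
`ℓ_J/ℓ_c`-Lipschitz, so the equilibria of the graphon game are the profiles `a(z)` with
`z = 𝐖 b(a(z), z)`, the fixed points of a contraction of `L²(I)`.

In the finite game the shocks average out: since they are centred and uncorrelated, the random
aggregates of an equilibrium `α` stay, in quadratic mean over the players, within `O(‖w^N‖₂/√N)` of
the solution `z̄` of `z̄_i = N⁻¹ ∑_j W_ij b(α_j, z̄_j)`, and a single player moves his own aggregate
by no more than that. Strong convexity turns the equilibrium property into `α ≈ a(z̄)` in mean
square.

Convergence in the cut norm is weak convergence in `L²(I × I)`, so together with convergence of the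
norms it gives `w^N → w` in `L²` up to relabelling. Hence `z̄` nearly satisfies the fixed point
equation of the limit game, and the contraction property brings it close to the limit aggregate. -/

noncomputable section

namespace GraphonGame

open scoped NNReal ENNReal

/-! ### Minimizers of strongly convex functions -/

section StrongConvex

variable {E : Type*} [NormedAddCommGroup E] [NormedSpace ℝ E] {s : Set E} {m : ℝ} {f g : E → ℝ}

theorem add_sq_le_of_isMinOn_of_strongConvexOn (hf : StrongConvexOn s m f) {a x : E} (ha : a ∈ s)
    (hmin : IsMinOn f s a) (hx : x ∈ s) : f a + m / 2 * ‖x - a‖ ^ 2 ≤ f x := by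
  set d := m / 2 * ‖x - a‖ ^ 2
  have hsegment : ∀ t ∈ Set.Ioo (0 : ℝ) 1, (1 - t) * d ≤ f x - f a := by
    rintro t ⟨ht₀, ht₁⟩
    have hconv : f (t • x + (1 - t) • a) ≤ t * f x + (1 - t) * f a - t * (1 - t) * d :=
      hf.2 hx ha ht₀.le (sub_nonneg.2 ht₁.le) (add_sub_cancel t 1)
    have hle : f a ≤ f (t • x + (1 - t) • a) :=
      hmin (hf.1 hx ha ht₀.le (sub_nonneg.2 ht₁.le) (add_sub_cancel t 1))
    refine le_of_mul_le_mul_left ?_ ht₀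
    linarith
  have hlim : Tendsto (fun t : ℝ => (1 - t) * d) (𝓝[>] 0) (𝓝 ((1 - 0) * d)) :=
    (Continuous.tendsto (by fun_prop) 0).mono_left nhdsWithin_le_nhds
  linarith [le_of_tendsto hlim (eventually_of_mem (Ioo_mem_nhdsGT one_pos) hsegment)]

theorem mul_norm_sub_le_of_strongConvexOn (hf : StrongConvexOn s m f) (hg : StrongConvexOn s m g)
    {a b : E} (ha : a ∈ s) (hb : b ∈ s) (hfa : IsMinOn f s a) (hgb : IsMinOn g s b) {L : ℝ}
    (hL : 0 ≤ L) (h : |(f b - g b) - (f a - g a)| ≤ L * ‖b - a‖) : m * ‖b - a‖ ≤ L := by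
  rcases eq_or_ne b a with rfl | hne
  · simpa using hL
  have hf' := add_sq_le_of_isMinOn_of_strongConvexOn hf ha hfa hb
  have hg' := add_sq_le_of_isMinOn_of_strongConvexOn hg hb hgb ha
  rw [norm_sub_rev] at hg'
  refine le_of_mul_le_mul_right ?_ (norm_pos_iff.2 (sub_ne_zero.2 hne))
  linarith [le_of_abs_le h]

/-- A lower bound on the unit ball around `x₀` controls a convex function along the rays from `x₀`;
strong convexity then makes it eventually exceed `f x₀`. -/
theorem le_of_strongConvexOn_of_lowerBound (hf : StrongConvexOn s m f) (hm : 0 < m) {x₀ x : E}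
    (hx₀ : x₀ ∈ s) (hx : x ∈ s) {p : ℝ} (hp : ∀ y ∈ s ∩ Metric.closedBall x₀ 1, p ≤ f y)
    (hfar : 1 + 2 * (f x₀ - p) / m ≤ ‖x - x₀‖) : f x₀ ≤ f x := by
  set r := ‖x - x₀‖
  have hpx₀ : p ≤ f x₀ := hp x₀ ⟨hx₀, Metric.mem_closedBall_self zero_le_one⟩
  have hr : 1 ≤ r := by
    have : 0 ≤ 2 * (f x₀ - p) / m := div_nonneg (by linarith) hm.le
    linarith
  have hr₀ : 0 < r := by linarith
  have ht : 0 ≤ 1 - r⁻¹ := sub_nonneg.2 (inv_le_one_of_one_le₀ hr)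
  have hball : r⁻¹ • x + (1 - r⁻¹) • x₀ ∈ Metric.closedBall x₀ 1 := by
    have : r⁻¹ • x + (1 - r⁻¹) • x₀ - x₀ = r⁻¹ • (x - x₀) := by module
    rw [mem_closedBall_iff_norm, this, norm_smul, Real.norm_of_nonneg (inv_nonneg.2 hr₀.le),
      inv_mul_cancel₀ hr₀.ne']
  have hlow := hp _ ⟨hf.1 hx hx₀ (inv_nonneg.2 hr₀.le) ht (add_sub_cancel _ _), hball⟩
  have hconv := hlow.trans (hf.2 hx hx₀ (inv_nonneg.2 hr₀.le) ht (add_sub_cancel _ _))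
  have hscaled : r * p ≤ f x + (r - 1) * f x₀ - (r - 1) * (m / 2 * r) := by
    calc r * p ≤ r * (r⁻¹ * f x + (1 - r⁻¹) * f x₀ - r⁻¹ * (1 - r⁻¹) * (m / 2 * r ^ 2)) :=
          mul_le_mul_of_nonneg_left hconv hr₀.le
      _ = _ := by field_simp
  have hgain : 2 * (f x₀ - p) ≤ m * (r - 1) := by
    rw [← div_le_iff₀' hm]
    linarith
  nlinarith

theorem exists_isMinOn_of_strongConvexOn [ProperSpace E] (hf : StrongConvexOn s m f) (hm : 0 < m)
    (hs : s.Nonempty) (hsc : IsClosed s) (hfc : ContinuousOn f s) : ∃ a ∈ s, IsMinOn f s a := by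
  obtain ⟨x₀, hx₀⟩ := hs
  obtain ⟨p, -, hp⟩ := ((isCompact_closedBall x₀ 1).inter_left hsc).exists_isMinOn
    ⟨x₀, hx₀, Metric.mem_closedBall_self zero_le_one⟩ (hfc.mono Set.inter_subset_left)
  refine hfc.exists_isMinOn' hsc hx₀ ?_
  have hfar := (tendsto_dist_right_cocompact_atTop x₀).eventually_ge_atTop
    (1 + 2 * (f x₀ - f p) / m)
  filter_upwards [hfar.filter_mono inf_le_left, eventually_inf_principal.2 (.of_forall fun _ => id)]
    with x hxr hx
  exact le_of_strongConvexOn_of_lowerBound hf hm hx₀ hx (fun y hy => hp hy)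
    (dist_eq_norm x x₀ ▸ hxr)

end StrongConvex

/-! ### Best replies and the drift -/

section BestReply

variable {A : Set ℝ} {b : ℝ → ℝ → ℝ} {f : ℝ → ℝ → ℝ → ℝ} {μ₀ : Measure ℝ} {lc lJ : ℝ} {a : ℝ → ℝ}

/-- `a` assigns to every deterministic aggregate `z` an action of least cost `𝒥(·, z)`. -/
def IsBestReply (A : Set ℝ) (b : ℝ → ℝ → ℝ) (f : ℝ → ℝ → ℝ → ℝ) (μ₀ : Measure ℝ) (a : ℝ → ℝ) :
    Prop :=
  ∀ z, a z ∈ A ∧ IsMinOn (fun α => cost b f μ₀ α z) A (a z)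

theorem CostRegular.lJ_nonneg (hJ : CostRegular A b f μ₀ lc lJ) (hA : A.Nonempty) : 0 ≤ lJ := by
  obtain ⟨α, hα⟩ := hA
  simpa using (abs_nonneg _).trans (hJ.2.2 α hα 0 1)

theorem CostRegular.exists_isBestReply (hJ : CostRegular A b f μ₀ lc lJ) (hA : A.Nonempty)
    (hAc : IsClosed A) : ∃ a, IsBestReply A b f μ₀ a := by
  choose a ha hmin using fun z => exists_isMinOn_of_strongConvexOn (hJ.2.1 z).2 hJ.1 hA hAc
    (hJ.2.1 z).1.continuousOn
  exact ⟨a, fun z => ⟨ha z, hmin z⟩⟩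

theorem CostRegular.cost_add_sq_le (hJ : CostRegular A b f μ₀ lc lJ) (ha : IsBestReply A b f μ₀ a)
    {β : ℝ} (hβ : β ∈ A) (z : ℝ) :
    cost b f μ₀ (a z) z + lc / 2 * (β - a z) ^ 2 ≤ cost b f μ₀ β z := by
  simpa only [Real.norm_eq_abs, sq_abs] using
    add_sq_le_of_isMinOn_of_strongConvexOn (hJ.2.1 z).2 (ha z).1 (ha z).2 hβ

theorem CostRegular.eq_bestReply (hJ : CostRegular A b f μ₀ lc lJ) (ha : IsBestReply A b f μ₀ a)
    {β z : ℝ} (hβ : β ∈ A) (hle : cost b f μ₀ β z ≤ cost b f μ₀ (a z) z) : β = a z := by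
  have hgrowth := hJ.cost_add_sq_le ha hβ z
  have hlc := hJ.1
  by_contra hne
  have : 0 < lc / 2 * (β - a z) ^ 2 := mul_pos (by linarith) (sq_pos_of_ne_zero (sub_ne_zero.2 hne))
  linarith

theorem CostRegular.abs_cost_sub_sub_le (hJ : CostRegular A b f μ₀ lc lJ) {α β : ℝ} (hα : α ∈ A)
    (hβ : β ∈ A) (z z' : ℝ) :
    |(cost b f μ₀ β z - cost b f μ₀ β z') - (cost b f μ₀ α z - cost b f μ₀ α z')| ≤
      lJ * |z - z'| * |β - α| := by
  have hd : ∀ z, DifferentiableOn ℝ (fun α => cost b f μ₀ α z) A := fun z =>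
    (hJ.2.1 z).1.differentiableOn one_ne_zero
  refine (hJ.2.1 z).2.1.norm_image_sub_le_of_norm_derivWithin_le ((hd z).fun_sub (hd z'))
    (fun x hx => ?_) hα hβ
  by_cases hx' : UniqueDiffWithinAt ℝ A x
  · rw [derivWithin_fun_sub (hd z x hx) (hd z' x hx)]
    exact hJ.2.2 x hx z' z
  · rw [derivWithin_zero_of_not_uniqueDiffWithinAt hx', norm_zero]
    exact mul_nonneg (hJ.lJ_nonneg ⟨α, hα⟩) (abs_nonneg _)

theorem CostRegular.lipschitzWith_bestReply (hJ : CostRegular A b f μ₀ lc lJ)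
    (ha : IsBestReply A b f μ₀ a) : LipschitzWith (lJ / lc).toNNReal a := by
  have hlJ := hJ.lJ_nonneg ⟨a 0, (ha 0).1⟩
  refine LipschitzWith.of_dist_le_mul fun z z' => ?_
  rw [Real.coe_toNNReal _ (div_nonneg hlJ hJ.1.le), div_mul_eq_mul_div, le_div_iff₀' hJ.1,
    dist_comm, dist_comm z]
  simp only [Real.dist_eq]
  exact mul_norm_sub_le_of_strongConvexOn (hJ.2.1 z).2 (hJ.2.1 z').2 (ha z).1 (ha z').1
    (ha z).2 (ha z').2 (mul_nonneg hlJ (abs_nonneg _))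
    (abs_sub_comm z z' ▸ hJ.abs_cost_sub_sub_le (ha z).1 (ha z').1 z z')

end BestReply

section Drift

variable {A : Set ℝ} {b : ℝ → ℝ → ℝ} {cα cz : ℝ}

theorem LipschitzDrift.abs_sub_le (hb : LipschitzDrift A b cα cz) {α α' : ℝ} (hα : α ∈ A)
    (hα' : α' ∈ A) (z z' : ℝ) : |b α z - b α' z'| ≤ √cα * |α - α'| + √cz * |z - z'| := by
  refine le_of_sq_le_sq ?_ (by positivity)
  have hcross : 0 ≤ √cα * |α - α'| * (√cz * |z - z'|) := by positivity
  calc |b α z - b α' z'| ^ 2 ≤ cα * |α - α'| ^ 2 + cz * |z - z'| ^ 2 := hb.2.2 α hα α' hα' z z'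
    _ = (√cα * |α - α'|) ^ 2 + (√cz * |z - z'|) ^ 2 := by
      rw [mul_pow, mul_pow, Real.sq_sqrt hb.1, Real.sq_sqrt hb.2.1]
    _ ≤ (√cα * |α - α'| + √cz * |z - z'|) ^ 2 := by linarith

theorem LipschitzDrift.lipschitzWith (hb : LipschitzDrift A b cα cz) {α : ℝ} (hα : α ∈ A) :
    LipschitzWith (√cz).toNNReal (b α) :=
  LipschitzWith.of_dist_le_mul fun z z' => by
    simpa [Real.dist_eq, Real.sqrt_nonneg] using hb.abs_sub_le hα hα z z'

theorem LipschitzDrift.continuousOn (hb : LipschitzDrift A b cα cz) :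
    ContinuousOn (fun p : ℝ × ℝ => b p.1 p.2) (A ×ˢ Set.univ) := by
  intro p hp
  rw [ContinuousWithinAt, tendsto_iff_dist_tendsto_zero]
  have hlim : Tendsto (fun q : ℝ × ℝ => √cα * |q.1 - p.1| + √cz * |q.2 - p.2|)
      (𝓝[A ×ˢ Set.univ] p) (𝓝 (√cα * |p.1 - p.1| + √cz * |p.2 - p.2|)) :=
    (Continuous.tendsto (by fun_prop) p).mono_left nhdsWithin_le_nhds
  simp only [sub_self, abs_zero, mul_zero, add_zero] at hlim
  refine squeeze_zero' (.of_forall fun _ => dist_nonneg) ?_ hlim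
  filter_upwards [self_mem_nhdsWithin] with q hq
  exact hb.abs_sub_le hq.1 hp.1 q.2 p.2

theorem LipschitzDrift.aestronglyMeasurable_comp {X : Type*} [MeasurableSpace X] {μ : Measure X}
    (hb : LipschitzDrift A b cα cz) (hAc : IsClosed A)
    {α z : X → ℝ} (hα : AEStronglyMeasurable α μ) (hz : AEStronglyMeasurable z μ)
    (hαA : ∀ᵐ x ∂μ, α x ∈ A) : AEStronglyMeasurable (fun x => b (α x) (z x)) μ := by
  have hpair : AEMeasurable (fun x => (α x, z x)) μ := hα.aemeasurable.prodMk hz.aemeasurable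
  have hmeas : MeasurableSet (A ×ˢ Set.univ : Set (ℝ × ℝ)) := hAc.measurableSet.prod .univ
  have hconc : (μ.map fun x => (α x, z x)).restrict (A ×ˢ Set.univ) = μ.map fun x => (α x, z x) :=
    Measure.restrict_eq_self_of_ae_mem <| (ae_map_iff hpair hmeas).2 <|
      hαA.mono fun _ hx => ⟨hx, Set.mem_univ _⟩
  have hbmeas := hb.continuousOn.aemeasurable (μ := μ.map fun x => (α x, z x)) hmeas
  rw [hconc] at hbmeas
  exact (hbmeas.comp_aemeasurable hpair).aestronglyMeasurable

end Drift

/-! ### Superposition operators -/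

section Superposition

variable {X E F : Type*} [MeasurableSpace X] {μ : Measure X} [NormedAddCommGroup E]
  [NormedAddCommGroup F] {p : ℝ≥0∞} {K : ℝ≥0}

theorem memLp_comp_of_lipschitzWith [IsFiniteMeasure μ] {h : E → F} (hh : LipschitzWith K h)
    {z : X → E} (hz : MemLp z p μ) : MemLp (fun x => h (z x)) p μ := by
  have hcentred : MemLp (fun x => h (z x) - h 0) p μ :=
    LipschitzWith.comp_memLp (g := fun s => h s - h 0) (hh.sub (.const (h 0))) (sub_self _) hz
  simpa only [Pi.add_def, sub_add_cancel] using hcentred.add (memLp_const (h 0))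

/-- The superposition (Nemytskii) operator `z ↦ g(·, z(·))` of `Lᵖ`. -/
def superposition (g : X → E → F) (hg : ∀ z : Lp E p μ, MemLp (fun x => g x (z x)) p μ)
    (z : Lp E p μ) : Lp F p μ :=
  (hg z).toLp _

theorem coeFn_superposition {g : X → E → F} (hg : ∀ z : Lp E p μ, MemLp (fun x => g x (z x)) p μ)
    (z : Lp E p μ) : superposition g hg z =ᵐ[μ] fun x => g x (z x) :=
  (hg z).coeFn_toLp

theorem lipschitzWith_superposition [Fact (1 ≤ p)] {g : X → E → F}
    (hg : ∀ z : Lp E p μ, MemLp (fun x => g x (z x)) p μ) (hK : ∀ᵐ x ∂μ, LipschitzWith K (g x)) :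
    LipschitzWith K (superposition g hg) := by
  refine LipschitzWith.of_dist_le_mul fun z z' => ?_
  rw [dist_eq_norm, dist_eq_norm]
  refine Lp.norm_le_mul_norm_of_ae_le_mul ?_
  filter_upwards [hK, Lp.coeFn_sub (superposition g hg z) (superposition g hg z'),
    Lp.coeFn_sub z z', coeFn_superposition hg z, coeFn_superposition hg z'] with x hx h₁ h₂ h₃ h₄
  rw [h₁, h₂, Pi.sub_apply, Pi.sub_apply, h₃, h₄]
  exact hx.norm_sub_le _ _

/-- Composition with a Lipschitz function, as a superposition operator. -/
def compLipschitz [IsFiniteMeasure μ] {h : E → F} (hh : LipschitzWith K h) : Lp E p μ → Lp F p μ :=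
  superposition (fun _ => h) fun z => memLp_comp_of_lipschitzWith hh (Lp.memLp z)

theorem coeFn_compLipschitz [IsFiniteMeasure μ] {h : E → F} (hh : LipschitzWith K h)
    (z : Lp E p μ) : compLipschitz hh z =ᵐ[μ] fun x => h (z x) :=
  coeFn_superposition _ z

theorem lipschitzWith_compLipschitz [IsFiniteMeasure μ] [Fact (1 ≤ p)] {h : E → F}
    (hh : LipschitzWith K h) : LipschitzWith K (compLipschitz hh : Lp E p μ → Lp F p μ) :=
  lipschitzWith_superposition _ (.of_forall fun _ => hh)

end Superposition

theorem contractingWith_clm_comp {E : Type*} [NormedAddCommGroup E] [NormedSpace ℝ E]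
    {T : E →L[ℝ] E} {g : E → E} {K ρ : ℝ≥0} (hg : LipschitzWith K g) (hT : ‖T‖ * K ≤ ρ)
    (hρ : ρ < 1) : ContractingWith ρ (T ∘ g) :=
  ⟨hρ, (T.lipschitz.comp hg).weaken hT⟩

section SquareIntegrable

variable {X : Type*} [MeasurableSpace X] {μ : Measure X} {f g : X → ℝ}

theorem inner_toLp (hf : MemLp f 2 μ) (hg : MemLp g 2 μ) :
    inner ℝ (hf.toLp f) (hg.toLp g) = ∫ x, f x * g x ∂μ := by
  rw [L2.inner_def]
  refine integral_congr_ae ?_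
  filter_upwards [hf.coeFn_toLp, hg.coeFn_toLp] with x hx hy
  simp [hx, hy, mul_comm]

theorem norm_toLp_sq (hf : MemLp f 2 μ) : ‖hf.toLp f‖ ^ 2 = ∫ x, f x ^ 2 ∂μ := by
  rw [← real_inner_self_eq_norm_sq, inner_toLp]
  simp only [sq]

theorem integral_mul_sq_le (hf : MemLp f 2 μ) (hg : MemLp g 2 μ) :
    (∫ x, f x * g x ∂μ) ^ 2 ≤ (∫ x, f x ^ 2 ∂μ) * ∫ x, g x ^ 2 ∂μ := by
  rw [← inner_toLp hf hg, ← norm_toLp_sq hf, ← norm_toLp_sq hg, ← mul_pow]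
  exact sq_le_sq.2 <| (abs_real_inner_le_norm _ _).trans (le_abs_self _)

end SquareIntegrable

/-! ### Square-integrable kernels and their operators -/

/-- The space `L²(I)`. -/
local notation "L²I" => Lp ℝ 2 (volume : Measure I)

/-- A square-integrable kernel on the unit square: a graphon without the symmetry. -/
def IsL2Kernel (w : I → I → ℝ) : Prop :=
  MemLp (fun p : I × I => w p.1 p.2) 2 volume

theorem graphonNorm_nonneg (w : I → I → ℝ) : 0 ≤ graphonNorm w := Real.sqrt_nonneg _

theorem graphonNorm_sq (w : I → I → ℝ) : graphonNorm w ^ 2 = ∫ p : I × I, w p.1 p.2 ^ 2 :=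
  Real.sq_sqrt (integral_nonneg fun _ => sq_nonneg _)

theorem IsGraphon.isL2Kernel {w : I → I → ℝ} (hw : IsGraphon w) : IsL2Kernel w :=
  (memLp_two_iff_integrable_sq hw.measurable.aestronglyMeasurable).2 hw.integrable_sq

namespace IsL2Kernel

variable {w w' : I → I → ℝ} {g : I → ℝ}

theorem sub (hw : IsL2Kernel w) (hw' : IsL2Kernel w') : IsL2Kernel fun x y => w x y - w' x y :=
  MemLp.sub hw hw'

theorem integrable_sq_prod (hw : IsL2Kernel w) :
    Integrable (fun p : I × I => w p.1 p.2 ^ 2) (volume.prod volume) :=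
  MemLp.integrable_sq hw

theorem ae_memLp (hw : IsL2Kernel w) : ∀ᵐ x, MemLp (w x) 2 volume := by
  have hmeas : AEStronglyMeasurable (fun p : I × I => w p.1 p.2) (volume.prod volume) := hw.1
  filter_upwards [hw.integrable_sq_prod.prod_right_ae, hmeas.prodMk_left] with x hx hx'
  exact (memLp_two_iff_integrable_sq hx').2 hx

theorem graphonOp_sq_le (hw : IsL2Kernel w) (hg : MemLp g 2 volume) :
    ∀ᵐ x, graphonOp w g x ^ 2 ≤ (∫ y, w x y ^ 2) * ∫ y, g y ^ 2 := by
  filter_upwards [hw.ae_memLp] with x hx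
  exact integral_mul_sq_le hx hg

theorem memLp_graphonOp (hw : IsL2Kernel w) (hg : MemLp g 2 volume) :
    MemLp (graphonOp w g) 2 volume := by
  have hprod : AEStronglyMeasurable (fun p : I × I => w p.1 p.2 * g p.2) (volume.prod volume) :=
    AEStronglyMeasurable.mul hw.1 hg.1.comp_snd
  have hmeas : AEStronglyMeasurable (graphonOp w g) volume := hprod.integral_prod_right'
  rw [memLp_two_iff_integrable_sq hmeas]
  refine (hw.integrable_sq_prod.integral_prod_left.mul_const (∫ y, g y ^ 2)).mono' (hmeas.pow 2) ?_
  filter_upwards [hw.graphonOp_sq_le hg] with x hx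
  rwa [Real.norm_of_nonneg (sq_nonneg _)]

theorem norm_toLp_graphonOp_le (hw : IsL2Kernel w) (hg : MemLp g 2 volume) :
    ‖(hw.memLp_graphonOp hg).toLp _‖ ≤ graphonNorm w * ‖hg.toLp g‖ := by
  refine le_of_sq_le_sq ?_ (mul_nonneg (graphonNorm_nonneg _) (norm_nonneg _))
  rw [mul_pow, norm_toLp_sq, norm_toLp_sq, graphonNorm_sq, Measure.volume_eq_prod,
    integral_prod _ hw.integrable_sq_prod, ← integral_mul_const]
  exact integral_mono_ae (hw.memLp_graphonOp hg).integrable_sq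
    (hw.integrable_sq_prod.integral_prod_left.mul_const _) (hw.graphonOp_sq_le hg)

/-- The integral operator `𝐖` of a square-integrable kernel, as a bounded operator on `L²(I)`. -/
def toCLM (hw : IsL2Kernel w) : L²I →L[ℝ] L²I :=
  LinearMap.mkContinuous
    { toFun u := (hw.memLp_graphonOp (Lp.memLp u)).toLp _
      map_add' u v := by
        rw [← MemLp.toLp_add, MemLp.toLp_eq_toLp_iff]
        filter_upwards [hw.ae_memLp] with x hx
        refine (integral_congr_ae ?_).trans
          (integral_add (hx.integrable_mul (Lp.memLp u)) (hx.integrable_mul (Lp.memLp v)))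
        filter_upwards [Lp.coeFn_add u v] with y hy
        simp only [hy, Pi.add_apply, mul_add]
      map_smul' c u := by
        rw [RingHom.id_apply, ← MemLp.toLp_const_smul, MemLp.toLp_eq_toLp_iff]
        refine .of_forall fun x => ?_
        rw [Pi.smul_apply, smul_eq_mul, graphonOp, graphonOp, ← integral_const_mul]
        refine integral_congr_ae ?_
        filter_upwards [Lp.coeFn_smul c u] with y hy
        rw [hy, Pi.smul_apply, smul_eq_mul, mul_left_comm] }
    (graphonNorm w) fun u =>
      (hw.norm_toLp_graphonOp_le (Lp.memLp u)).trans_eq (by rw [Lp.toLp_coeFn])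

theorem toCLM_apply (hw : IsL2Kernel w) (u : L²I) :
    hw.toCLM u = (hw.memLp_graphonOp (Lp.memLp u)).toLp _ := rfl

theorem coeFn_toCLM (hw : IsL2Kernel w) {u : L²I} (hu : u =ᵐ[volume] g) :
    hw.toCLM u =ᵐ[volume] graphonOp w g := by
  filter_upwards [(hw.memLp_graphonOp (Lp.memLp u)).coeFn_toLp] with x hx
  rw [toCLM_apply, hx]
  refine integral_congr_ae ?_
  filter_upwards [hu] with y hy
  rw [hy]

theorem norm_toCLM_le_graphonNorm (hw : IsL2Kernel w) : ‖hw.toCLM‖ ≤ graphonNorm w :=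
  LinearMap.mkContinuous_norm_le _ (graphonNorm_nonneg w) _

theorem norm_toCLM_le_graphonOpNorm (hw : IsL2Kernel w) : ‖hw.toCLM‖ ≤ graphonOpNorm w := by
  have hnorm : ∀ u : L²I, normL2 (graphonOp w u) = ‖hw.toCLM u‖ := fun u =>
    (Lp.norm_toLp _ (hw.memLp_graphonOp (Lp.memLp u))).symm
  refine ContinuousLinearMap.opNorm_le_of_unit_norm (Real.sSup_nonneg ?_) fun u hu =>
    le_csSup ⟨graphonNorm w, ?_⟩ ⟨u, hu, (hnorm u).symm⟩
  · rintro r ⟨u, -, rfl⟩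
    exact ENNReal.toReal_nonneg
  · rintro r ⟨u, hu, rfl⟩
    rw [hnorm, ← mul_one (graphonNorm w), ← hu]
    exact hw.toCLM.le_of_opNorm_le hw.norm_toCLM_le_graphonNorm u

theorem toCLM_sub (hw : IsL2Kernel w) (hw' : IsL2Kernel w') :
    (hw.sub hw').toCLM = hw.toCLM - hw'.toCLM := by
  ext1 u
  rw [sub_apply, toCLM_apply, toCLM_apply, toCLM_apply, ← MemLp.toLp_sub,
    MemLp.toLp_eq_toLp_iff]
  filter_upwards [hw.ae_memLp, hw'.ae_memLp] with x hx hx'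
  simp only [Pi.sub_apply, graphonOp, sub_mul]
  exact integral_sub (hx.integrable_mul (Lp.memLp u)) (hx'.integrable_mul (Lp.memLp u))

theorem norm_toCLM_sub_le (hw : IsL2Kernel w) (hw' : IsL2Kernel w') :
    ‖hw.toCLM - hw'.toCLM‖ ≤ graphonNorm fun x y => w x y - w' x y :=
  toCLM_sub hw hw' ▸ (hw.sub hw').norm_toCLM_le_graphonNorm

theorem isFixedPt_toCLM_comp_superposition (hw : IsL2Kernel w) {g : I → ℝ → ℝ}
    (hg : ∀ z : L²I, MemLp (fun y => g y (z y)) 2 volume) {z : L²I} :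
    Function.IsFixedPt (hw.toCLM ∘ superposition g hg) z ↔
      ∀ᵐ x, z x = ∫ y, w x y * g y (z y) := by
  have hT := hw.coeFn_toCLM (coeFn_superposition hg z)
  rw [Function.IsFixedPt, Function.comp_apply, eq_comm, Lp.ext_iff]
  exact ⟨fun h => h.trans hT, fun h => EventuallyEq.trans h hT.symm⟩

end IsL2Kernel

/-! ### Equilibria of the graphon game -/

section GraphonEquilibrium

variable {A : Set ℝ} {b : ℝ → ℝ → ℝ} {f : ℝ → ℝ → ℝ → ℝ} {μ₀ : Measure ℝ} {cα cz c₀ lc lJ : ℝ}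
  {w : I → I → ℝ} {a : ℝ → ℝ} {κ : ℝ≥0}

theorem LipschitzDrift.lipschitzWith_feedback (hb : LipschitzDrift A b cα cz)
    (haA : ∀ z, a z ∈ A) (ha : LipschitzWith κ a) :
    LipschitzWith ((√cα).toNNReal * κ + (√cz).toNNReal) fun z => b (a z) z := by
  refine LipschitzWith.of_dist_le_mul fun z z' => (hb.abs_sub_le (haA z) (haA z') z z').trans ?_
  have hκ := mul_le_mul_of_nonneg_left (ha.dist_le_mul z z') (Real.sqrt_nonneg cα)
  rw [Real.dist_eq, Real.dist_eq] at hκ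
  simp only [NNReal.coe_add, NNReal.coe_mul, Real.coe_toNNReal _ (Real.sqrt_nonneg _),
    Real.dist_eq]
  linarith

theorem LipschitzDrift.memLp_drift (hb : LipschitzDrift A b cα cz) (hb_bdd : BoundedDrift A b c₀)
    (hAc : IsClosed A) {α : L²I} (hα : ∀ᵐ y, α y ∈ A) (z : L²I) :
    MemLp (fun y => b (α y) (z y)) 2 volume :=
  MemLp.of_bound (hb.aestronglyMeasurable_comp hAc (Lp.aestronglyMeasurable α)
    (Lp.aestronglyMeasurable z) hα) c₀ (hα.mono fun _ hx => hb_bdd.2 _ hx _)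

theorem existsUnique_isGraphonAggregate (hb : LipschitzDrift A b cα cz)
    (hb_bdd : BoundedDrift A b c₀) (hAc : IsClosed A) (hw : IsL2Kernel w)
    (hsmall : ‖hw.toCLM‖ * √cz < 1) {α : L²I} (hα : ∀ᵐ y, α y ∈ A) :
    ∃! z, IsGraphonAggregate b w α z := by
  have hg := hb.memLp_drift hb_bdd hAc hα
  have hcontr : ContractingWith (‖hw.toCLM‖₊ * (√cz).toNNReal)
      (hw.toCLM ∘ superposition (fun y => b (α y)) hg) :=
    contractingWith_clm_comp (lipschitzWith_superposition hg (hα.mono fun _ => hb.lipschitzWith))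
      le_rfl (by simpa [← NNReal.coe_lt_coe, Real.sqrt_nonneg] using hsmall)
  exact ⟨_, (hw.isFixedPt_toCLM_comp_superposition hg).1 hcontr.fixedPoint_isFixedPt, fun z hz =>
    hcontr.fixedPoint_unique ((hw.isFixedPt_toCLM_comp_superposition hg).2 hz)⟩

theorem isGraphonAggregate_feedback_iff (hw : IsL2Kernel w)
    (hfb : LipschitzWith κ fun s => b (a s) s) {α z : L²I} (hα : α =ᵐ[volume] fun x => a (z x)) :
    IsGraphonAggregate b w α z ↔ Function.IsFixedPt (hw.toCLM ∘ compLipschitz hfb) z := by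
  have hdrift : ∀ x, ∫ y, w x y * b (α y) (z y) = ∫ y, w x y * b (a (z y)) (z y) := fun x =>
    integral_congr_ae <| hα.mono fun y hy => by simp only [hy]
  simp only [IsGraphonAggregate, hdrift]
  exact (hw.isFixedPt_toCLM_comp_superposition (g := fun _ s => b (a s) s) _).symm

theorem isGraphonNash_iff (hb : LipschitzDrift A b cα cz) (hb_bdd : BoundedDrift A b c₀)
    (hAc : IsClosed A) (hJ : CostRegular A b f μ₀ lc lJ) (hw : IsL2Kernel w)
    (hsmall : ‖hw.toCLM‖ * √cz < 1) (ha : IsBestReply A b f μ₀ a) (haL : LipschitzWith κ a)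
    {κ' : ℝ≥0} (hfb : LipschitzWith κ' fun s => b (a s) s) {α : L²I} :
    IsGraphonNash A b f μ₀ w α ↔
      ∃ z, Function.IsFixedPt (hw.toCLM ∘ compLipschitz hfb) z ∧ α = compLipschitz haL z := by
  have hagg : ∀ {α}, α ∈ Admissible A → IsGraphonAggregate b w α (graphonAggregate b w α) :=
    fun hα => Classical.epsilon_spec
      (existsUnique_isGraphonAggregate hb hb_bdd hAc hw hsmall hα).exists
  constructor
  · rintro ⟨hα, -, hmin⟩
    have hreply : α =ᵐ[volume] fun x => a (graphonAggregate b w α x) := by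
      filter_upwards [hmin, hα] with x hx hxA
      exact hJ.eq_bestReply ha hxA (hx _ (ha _).1)
    exact ⟨graphonAggregate b w α, (isGraphonAggregate_feedback_iff hw hfb hreply).1 (hagg hα),
      Lp.ext (hreply.trans (coeFn_compLipschitz haL _).symm)⟩
  · rintro ⟨z, hz, rfl⟩
    have hreply := coeFn_compLipschitz haL z
    have hα : compLipschitz haL z ∈ Admissible A := hreply.mono fun x hx => hx ▸ (ha _).1
    have hz_eq : graphonAggregate b w (compLipschitz haL z) = z :=
      (existsUnique_isGraphonAggregate hb hb_bdd hAc hw hsmall hα).unique (hagg hα)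
        ((isGraphonAggregate_feedback_iff hw hfb hreply).2 hz)
    refine ⟨hα, hα, ?_⟩
    filter_upwards [hreply] with x hx β hβ
    rw [hx, hz_eq]
    exact (ha _).2 hβ

theorem IsL2Kernel.contractingWith_feedback (hw : IsL2Kernel w) {g : ℝ → ℝ}
    {κ rα rz : ℝ≥0} (hg : LipschitzWith (rα * κ + rz) g) (hsmall : rz * graphonOpNorm w < 1)
    (hcontr : κ * (rα * graphonOpNorm w / (1 - rz * graphonOpNorm w)) < 1) :
    ContractingWith (‖hw.toCLM‖₊ * (rα * κ + rz)) (hw.toCLM ∘ compLipschitz hg) := by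
  refine contractingWith_clm_comp (lipschitzWith_compLipschitz hg) le_rfl ?_
  rw [← mul_div_assoc, div_lt_one (sub_pos.2 hsmall)] at hcontr
  have hM := mul_le_mul_of_nonneg_right hw.norm_toCLM_le_graphonOpNorm (rα * κ + rz).coe_nonneg
  rw [← NNReal.coe_lt_coe, NNReal.coe_mul, NNReal.coe_one, coe_nnnorm]
  refine hM.trans_lt ?_
  push_cast
  linarith

end GraphonEquilibrium

/-! ### Cut convergence and convergence in `L²` -/

section WeakConvergence

variable {E ι : Type*} [NormedAddCommGroup E] [InnerProductSpace ℝ E] {l : Filter ι}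
  {u : ι → E} {M : ℝ≥0}

theorem isClosed_setOf_tendsto_inner_zero (hu : ∀ i, ‖u i‖ ≤ M) :
    IsClosed {g : E | Tendsto (fun i => inner ℝ g (u i)) l (𝓝 0)} := by
  have hlip : ∀ i, LipschitzWith M fun g : E => inner ℝ g (u i) := fun i =>
    LipschitzWith.of_dist_le_mul fun g g' => by
      rw [Real.dist_eq, ← inner_sub_left, dist_eq_norm, mul_comm]
      exact (abs_real_inner_le_norm _ _).trans
        (mul_le_mul_of_nonneg_left (hu i) (norm_nonneg _))
  exact (LipschitzWith.uniformEquicontinuous _ M hlip).equicontinuous.isClosed_setOfPred_tendsto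
    continuous_const

theorem tendsto_inner_zero_of_total [CompleteSpace E] (hu : ∀ i, ‖u i‖ ≤ M) {S : Set E}
    (htotal : ∀ g : E, (∀ s ∈ S, inner ℝ s g = 0) → g = 0)
    (hS : ∀ s ∈ S, Tendsto (fun i => inner ℝ s (u i)) l (𝓝 0)) (g : E) :
    Tendsto (fun i => inner ℝ g (u i)) l (𝓝 0) := by
  let V : Submodule ℝ E :=
    { carrier := {g | Tendsto (fun i => inner ℝ g (u i)) l (𝓝 0)}
      add_mem' := fun {g g'} hg hg' => by simpa [inner_add_left] using Tendsto.add hg hg'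
      zero_mem' := by simpa using tendsto_const_nhds
      smul_mem' := fun c g hg => by simpa [inner_smul_left] using Tendsto.const_mul c hg }
  have : CompleteSpace V := (isClosed_setOf_tendsto_inner_zero hu).completeSpace_coe
  have hVbot : Vᗮ = ⊥ := (Submodule.eq_bot_iff _).2 fun g hg =>
    htotal g fun s hs => V.mem_orthogonal g |>.1 hg s (hS s hs)
  have hVtop : V = ⊤ := V.orthogonal_eq_bot_iff.1 hVbot
  exact hVtop.ge Submodule.mem_top

end WeakConvergence

theorem ae_eq_zero_of_setIntegral_eq_zero_of_isPiSystem {X : Type*} [m : MeasurableSpace X]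
    {μ : Measure X} {C : Set (Set X)} (hm : m = .generateFrom C) (hC : IsPiSystem C) {g : X → ℝ}
    (hg : Integrable g μ) (huniv : ∫ x, g x ∂μ = 0) (hCg : ∀ s ∈ C, ∫ x in s, g x ∂μ = 0) :
    g =ᵐ[μ] 0 := by
  suffices h : ∀ s, MeasurableSet s → ∫ x in s, g x ∂μ = 0 from
    hg.ae_eq_zero_of_forall_setIntegral_eq_zero fun s hs _ => h s hs
  intro s hs
  induction s, hs using MeasurableSpace.induction_on_inter hm hC with
  | empty => simp
  | basic s hs => exact hCg s hs
  | compl s hs ih =>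
    rwa [← integral_add_compl hs hg, ih, zero_add] at huniv
  | iUnion s hdisj hs ih =>
    rw [integral_iUnion hs hdisj hg.integrableOn]
    simp only [ih, tsum_zero]

theorem tendsto_inner_zero_of_tendsto_setIntegral_prod {X Y ι : Type*} [MeasurableSpace X]
    [MeasurableSpace Y] {μ : Measure (X × Y)} [IsFiniteMeasure μ] {l : Filter ι}
    {u : ι → Lp ℝ 2 μ} {M : ℝ≥0} (hu : ∀ i, ‖u i‖ ≤ M)
    (hrect : ∀ (S : Set X) (T : Set Y), MeasurableSet S → MeasurableSet T →
      Tendsto (fun i => ∫ p in S ×ˢ T, u i p ∂μ) l (𝓝 0)) (g : Lp ℝ 2 μ) :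
    Tendsto (fun i => inner ℝ g (u i)) l (𝓝 0) := by
  refine tendsto_inner_zero_of_total hu (S := {h | ∃ (S : Set X) (T : Set Y)
    (hS : MeasurableSet S) (hT : MeasurableSet T),
    h = indicatorConstLp 2 (hS.prod hT) (measure_ne_top μ _) (1 : ℝ)}) (fun g hg => ?_) ?_ g
  · have hgrect : ∀ S T, MeasurableSet S → MeasurableSet T → ∫ p in S ×ˢ T, g p ∂μ = 0 :=
      fun S T hS hT => by
        rw [← L2.inner_indicatorConstLp_one (𝕜 := ℝ) (hS.prod hT) (measure_ne_top μ _)]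
        exact hg _ ⟨S, T, hS, hT, rfl⟩
    refine (Lp.eq_zero_iff_ae_eq_zero).2 <| ae_eq_zero_of_setIntegral_eq_zero_of_isPiSystem
      generateFrom_prod.symm isPiSystem_prod ((Lp.memLp g).integrable one_le_two) ?_ ?_
    · simpa using hgrect Set.univ Set.univ .univ .univ
    · rintro _ ⟨S, hS, T, hT, rfl⟩
      exact hgrect S T hS hT
  · rintro _ ⟨S, T, hS, hT, rfl⟩
    simpa only [L2.inner_indicatorConstLp_one] using hrect S T hS hT

theorem tendsto_of_tendsto_inner_of_tendsto_norm {E ι : Type*} [NormedAddCommGroup E]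
    [InnerProductSpace ℝ E] {l : Filter ι} {u : ι → E} {v : E}
    (hinner : Tendsto (fun i => inner ℝ v (u i - v)) l (𝓝 0))
    (hnorm : Tendsto (fun i => ‖u i‖) l (𝓝 ‖v‖)) : Tendsto u l (𝓝 v) := by
  have hexpand : ∀ i, ‖u i - v‖ ^ 2 = ‖u i‖ ^ 2 - ‖v‖ ^ 2 - 2 * inner ℝ v (u i - v) := fun i => by
    rw [norm_sub_sq_real, inner_sub_right, real_inner_self_eq_norm_sq, real_inner_comm]
    ring
  have hsq : Tendsto (fun i => ‖u i - v‖ ^ 2) l (𝓝 0) := by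
    have h := ((hnorm.pow 2).sub_const (‖v‖ ^ 2)).sub (hinner.const_mul 2)
    rw [sub_self, mul_zero, sub_zero] at h
    exact h.congr fun i => (hexpand i).symm
  rw [tendsto_iff_norm_sub_tendsto_zero]
  simpa [Real.sqrt_sq] using hsq.sqrt

namespace IsL2Kernel

variable {w w' : I → I → ℝ}

/-- A square-integrable kernel as an element of `L²(I × I)`. -/
def toL2 (hw : IsL2Kernel w) : Lp ℝ 2 (volume : Measure (I × I)) := MemLp.toLp _ hw

theorem coeFn_toL2 (hw : IsL2Kernel w) : hw.toL2 =ᵐ[volume] fun p : I × I => w p.1 p.2 :=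
  MemLp.coeFn_toLp hw

theorem toL2_sub (hw : IsL2Kernel w) (hw' : IsL2Kernel w') :
    (hw.sub hw').toL2 = hw.toL2 - hw'.toL2 :=
  MemLp.toLp_sub hw hw'

theorem norm_toL2 (hw : IsL2Kernel w) : ‖hw.toL2‖ = graphonNorm w := by
  rw [graphonNorm, ← norm_toLp_sq hw, Real.sqrt_sq (norm_nonneg _), toL2]

theorem abs_setIntegral_le_cutNorm (hw : IsL2Kernel w) {S T : Set I}
    (hS : MeasurableSet S) (hT : MeasurableSet T) :
    |∫ p in S ×ˢ T, w p.1 p.2| ≤ cutNorm w := by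
  refine le_csSup ⟨∫ p : I × I, |w p.1 p.2|, ?_⟩ ⟨S, T, hS, hT, rfl⟩
  rintro r ⟨S, T, -, -, rfl⟩
  exact abs_integral_le_integral_abs.trans
    (setIntegral_le_integral (MemLp.integrable one_le_two hw).abs
      (.of_forall fun _ => abs_nonneg _))

end IsL2Kernel

theorem cutNorm_nonneg (w : I → I → ℝ) : 0 ≤ cutNorm w := by
  refine Real.sSup_nonneg ?_
  rintro r ⟨S, T, -, -, rfl⟩
  exact abs_nonneg _

theorem IsL2Kernel.tendsto_graphonNorm_sub {w : I → I → ℝ} (hw : IsL2Kernel w) {v : ℕ → I → I → ℝ}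
    (hv : ∀ n, IsL2Kernel (v n))
    (hcut : Tendsto (fun n => cutNorm fun x y => v n x y - w x y) atTop (𝓝 0))
    (hnorm : Tendsto (fun n => graphonNorm (v n)) atTop (𝓝 (graphonNorm w))) :
    Tendsto (fun n => graphonNorm fun x y => v n x y - w x y) atTop (𝓝 0) := by
  simp only [← (hv _).norm_toL2, ← hw.norm_toL2] at hnorm
  obtain ⟨M, hM⟩ := (hnorm.add_const ‖hw.toL2‖).bddAbove_range
  have hbound : ∀ n, ‖(hv n).toL2 - hw.toL2‖ ≤ M.toNNReal := fun n =>
    (norm_sub_le _ _).trans ((hM ⟨n, rfl⟩).trans M.le_coe_toNNReal)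
  have hrect : ∀ S T : Set I, MeasurableSet S → MeasurableSet T →
      Tendsto (fun n => ∫ p in S ×ˢ T, ((hv n).toL2 - hw.toL2) p) atTop (𝓝 0) :=
    fun S T hS hT => squeeze_zero_norm (fun n => by
      rw [← IsL2Kernel.toL2_sub, integral_congr_ae (ae_restrict_of_ae ((hv n).sub hw).coeFn_toL2)]
      exact ((hv n).sub hw).abs_setIntegral_le_cutNorm hS hT) hcut
  simp only [← ((hv _).sub hw).norm_toL2]
  exact tendsto_iff_norm_sub_tendsto_zero.1 <| tendsto_of_tendsto_inner_of_tendsto_norm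
    (tendsto_inner_zero_of_tendsto_setIntegral_prod hbound hrect _) hnorm

/-! ### Relabelling of the players -/

namespace MPEquiv

instance : Nonempty MPEquiv := ⟨⟨MeasurableEquiv.refl I, MeasurePreserving.id volume⟩⟩

theorem measurePreserving_prodMap (φ : MPEquiv) :
    MeasurePreserving (Prod.map φ.1 φ.1) (volume : Measure (I × I)) volume := by
  rw [Measure.volume_eq_prod]
  exact φ.2.prod φ.2

/-- The isometry `u ↦ u ∘ φ` of `L²(I)`. -/
def relabel (φ : MPEquiv) : L²I →ₗᵢ[ℝ] L²I := Lp.compMeasurePreservingₗᵢ ℝ φ.1 φ.2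

theorem coeFn_relabel (φ : MPEquiv) {u : L²I} {g : I → ℝ} (hu : u =ᵐ[volume] g) :
    φ.relabel u =ᵐ[volume] g ∘ φ.1 :=
  (Lp.coeFn_compMeasurePreserving u φ.2).trans (φ.2.quasiMeasurePreserving.ae_eq_comp hu)

theorem compLipschitz_relabel (φ : MPEquiv) {K : ℝ≥0} {h : ℝ → ℝ} (hh : LipschitzWith K h)
    (u : L²I) : compLipschitz hh (φ.relabel u) = φ.relabel (compLipschitz hh u) := by
  refine Lp.ext ?_
  filter_upwards [coeFn_compLipschitz hh (φ.relabel u), φ.coeFn_relabel (ae_eq_refl u),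
    φ.coeFn_relabel (coeFn_compLipschitz hh u)] with x h₁ h₂ h₃
  rw [h₁, h₂, h₃]
  rfl

end MPEquiv

theorem graphonNorm_relabel (w : I → I → ℝ) (φ : MPEquiv) :
    (graphonNorm fun x y => w (φ.1 x) (φ.1 y)) = graphonNorm w :=
  congrArg Real.sqrt <| φ.measurePreserving_prodMap.integral_comp
    (φ.1.prodCongr φ.1).measurableEmbedding fun p : I × I => w p.1 p.2 ^ 2

theorem IsL2Kernel.relabel {w : I → I → ℝ} (hw : IsL2Kernel w) (φ : MPEquiv) :
    IsL2Kernel fun x y => w (φ.1 x) (φ.1 y) :=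
  MemLp.comp_measurePreserving hw φ.measurePreserving_prodMap

theorem IsL2Kernel.toCLM_relabel {w : I → I → ℝ} (hw : IsL2Kernel w) (φ : MPEquiv) (u : L²I) :
    (hw.relabel φ).toCLM (φ.relabel u) = φ.relabel (hw.toCLM u) := by
  refine Lp.ext ?_
  filter_upwards [(hw.relabel φ).coeFn_toCLM (φ.coeFn_relabel (ae_eq_refl u)),
    φ.coeFn_relabel (hw.coeFn_toCLM (ae_eq_refl u))] with x h₁ h₂
  rw [h₁, h₂]
  exact φ.2.integral_comp φ.1.measurableEmbedding fun y => w (φ.1 x) y * u y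

theorem IsL2Kernel.norm_toCLM_le_norm_toCLM_relabel {w : I → I → ℝ} (hw : IsL2Kernel w)
    (φ : MPEquiv) : ‖hw.toCLM‖ ≤ ‖(hw.relabel φ).toCLM‖ := by
  refine hw.toCLM.opNorm_le_bound (norm_nonneg _) fun u => ?_
  rw [← φ.relabel.norm_map (hw.toCLM u), ← hw.toCLM_relabel φ, ← φ.relabel.norm_map u]
  exact ContinuousLinearMap.le_opNorm _ _

theorem IsL2Kernel.norm_toCLM_le_add_graphonNorm_relabel_sub {v w : I → I → ℝ}
    (hv : IsL2Kernel v) (hw : IsL2Kernel w) (φ : MPEquiv) :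
    ‖hv.toCLM‖ ≤ ‖hw.toCLM‖ + graphonNorm fun x y => v (φ.1 x) (φ.1 y) - w x y :=
  (hv.norm_toCLM_le_norm_toCLM_relabel φ).trans <| (norm_le_norm_add_norm_sub' _ _).trans <|
    add_le_add_right (norm_toCLM_sub_le (hv.relabel φ) hw) _

theorem IsL2Kernel.eventually_norm_toCLM_mul_le {w : I → I → ℝ} (hw : IsL2Kernel w)
    {v : ℕ → I → I → ℝ} (hv : ∀ n, IsL2Kernel (v n)) {φ : ℕ → MPEquiv}
    (hφ : Tendsto (fun n => graphonNorm fun x y => v n ((φ n).1 x) ((φ n).1 y) - w x y)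
      atTop (𝓝 0)) {r ρ : ℝ} (hr : 0 ≤ r) (hρ : ‖hw.toCLM‖ * r < ρ) :
    ∀ᶠ n in atTop, ‖(hv n).toCLM‖ * r ≤ ρ := by
  have hlim := (hφ.const_add ‖hw.toCLM‖).mul_const r
  rw [add_zero] at hlim
  filter_upwards [hlim.eventually_le_const hρ] with n hn
  exact (mul_le_mul_of_nonneg_right
    ((hv n).norm_toCLM_le_add_graphonNorm_relabel_sub hw (φ n)) hr).trans hn

theorem exists_relabel_tendsto_graphonNorm_sub {w : I → I → ℝ} (hw : IsL2Kernel w)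
    {v : ℕ → I → I → ℝ} (hv : ∀ n, IsL2Kernel (v n))
    (hcut : Tendsto (fun n => cutDist (v n) w) atTop (𝓝 0))
    (hnorm : Tendsto (fun n => graphonNorm (v n)) atTop (𝓝 (graphonNorm w))) :
    ∃ φ : ℕ → MPEquiv, Tendsto
      (fun n => graphonNorm fun x y => v n ((φ n).1 x) ((φ n).1 y) - w x y) atTop (𝓝 0) := by
  have hex : ∀ n : ℕ, ∃ φ : MPEquiv, cutNorm (fun x y => v n (φ.1 x) (φ.1 y) - w x y) <
      cutDist (v n) w + 1 / ((n : ℝ) + 1) := fun n =>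
    exists_lt_of_ciInf_lt (lt_add_of_pos_right _ Nat.one_div_pos_of_nat)
  choose φ hφ using hex
  refine ⟨φ, IsL2Kernel.tendsto_graphonNorm_sub hw (fun n => (hv n).relabel (φ n)) ?_ ?_⟩
  · refine squeeze_zero (fun n => cutNorm_nonneg _) (fun n => (hφ n).le) ?_
    simpa using hcut.add tendsto_one_div_add_atTop_nhds_zero_nat
  · simpa only [graphonNorm_relabel] using hnorm

theorem distS_le (α α' : I → ℝ) (φ : MPEquiv) : distS α α' ≤ normL2 fun x => α (φ.1 x) - α' x :=
  ciInf_le ⟨0, by rintro _ ⟨φ, rfl⟩; exact ENNReal.toReal_nonneg⟩ φ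

theorem distS_nonneg (α α' : I → ℝ) : 0 ≤ distS α α' :=
  Real.iInf_nonneg fun _ => ENNReal.toReal_nonneg

/-! ### Step functions and step graphons -/

section Step

variable {N : ℕ}

/-- The interval `[i/N, (i+1)/N)` on which `stepFun` takes its `i`-th value. -/
def cell (i : Fin N) : Set I := {x | ⌊(N : ℝ) * (x : ℝ)⌋₊ = i}

theorem mem_cell {i : Fin N} {x : I} : x ∈ cell i ↔ ⌊(N : ℝ) * (x : ℝ)⌋₊ = i := Iff.rfl

theorem measurableSet_cell (i : Fin N) : MeasurableSet (cell i) :=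
  (Nat.measurable_floor.comp (measurable_subtype_coe.const_mul (N : ℝ)))
    (measurableSet_singleton (i : ℕ))

theorem volume_real_cell (i : Fin N) : (volume : Measure I).real (cell i) = 1 / (N : ℝ) := by
  have hN : (0 : ℝ) < N := by exact_mod_cast i.pos
  have hi : (i : ℝ) + 1 ≤ N := by exact_mod_cast i.2
  have h₀ : (i : ℝ) / N ∈ I := ⟨by positivity, by rw [div_le_one hN]; linarith⟩
  have h₁ : ((i : ℝ) + 1) / N ∈ I := ⟨by positivity, by rwa [div_le_one hN]⟩
  have hcell : cell i = Set.Ico ⟨_, h₀⟩ ⟨_, h₁⟩ := by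
    ext x
    rw [mem_cell, Nat.floor_eq_iff (mul_nonneg hN.le x.2.1), Set.mem_Ico,
      ← Subtype.coe_le_coe, ← Subtype.coe_lt_coe, div_le_iff₀ hN, lt_div_iff₀ hN, mul_comm]
  have hlength : ((i : ℝ) + 1) / N - i / N = 1 / N := by ring
  rw [hcell, Measure.real, unitInterval.volume_Ico, hlength,
    ENNReal.toReal_ofReal (by positivity)]

theorem stepFun_zero_or_apply (x : I) :
    (∀ u : Fin N → ℝ, stepFun u x = 0) ∨ ∃ i, ∀ u : Fin N → ℝ, stepFun u x = u i := by
  by_cases h : ⌊(N : ℝ) * (x : ℝ)⌋₊ < N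
  · exact .inr ⟨⟨_, h⟩, fun u => by rw [stepFun, dif_pos h]⟩
  · exact .inl fun u => by rw [stepFun, dif_neg h]

theorem ae_exists_stepFun_eq_apply (hN : 0 < N) :
    ∀ᵐ x : I, ∃ i, ∀ u : Fin N → ℝ, stepFun u x = u i := by
  filter_upwards [compl_mem_ae_iff.2 (measure_singleton (1 : I))] with x hx
  have hx1 : (x : ℝ) < 1 := lt_of_le_of_ne x.2.2 fun h => hx (Subtype.ext h)
  have hN' : (0 : ℝ) < N := by exact_mod_cast hN
  have h : ⌊(N : ℝ) * (x : ℝ)⌋₊ < N := by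
    rw [Nat.floor_lt (mul_nonneg hN'.le x.2.1)]
    nlinarith
  exact ⟨⟨_, h⟩, fun u => by rw [stepFun, dif_pos h]⟩

theorem stepFun_eq_sum_indicator (u : Fin N → ℝ) (x : I) :
    stepFun u x = ∑ i, (cell i).indicator (fun _ => u i) x := by
  rw [stepFun]
  split_ifs with h
  · rw [Fintype.sum_eq_single ⟨_, h⟩ fun j hj =>
      Set.indicator_of_notMem (mt (fun hx => Fin.ext (mem_cell.1 hx).symm) hj) _,
      Set.indicator_of_mem (mem_cell.2 rfl)]
  · exact (Finset.sum_eq_zero fun i _ =>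
      Set.indicator_of_notMem (mt (fun hx => mem_cell.1 hx ▸ i.2) h) _).symm

theorem stepGraphon_eq_sum_indicator (W : Matrix (Fin N) (Fin N) ℝ) (p : I × I) :
    stepGraphon W p.1 p.2 = ∑ i, ∑ j, (cell i ×ˢ cell j).indicator (fun _ => W i j) p := by
  classical
  rw [stepGraphon, stepFun_eq_sum_indicator]
  refine Finset.sum_congr rfl fun i _ => ?_
  by_cases hi : p.1 ∈ cell i <;>
    simp [hi, stepFun_eq_sum_indicator, Set.indicator_apply, Set.mem_prod]

theorem memLp_stepFun (u : Fin N → ℝ) : MemLp (stepFun u) 2 volume := by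
  rw [funext (stepFun_eq_sum_indicator u)]
  exact memLp_finsetSum _ fun i _ =>
    memLp_indicator_const 2 (measurableSet_cell i) _ (.inr (measure_ne_top _ _))

theorem isL2Kernel_stepGraphon (W : Matrix (Fin N) (Fin N) ℝ) : IsL2Kernel (stepGraphon W) := by
  rw [IsL2Kernel, funext (stepGraphon_eq_sum_indicator W)]
  exact memLp_finsetSum _ fun i _ => memLp_finsetSum _ fun j _ => memLp_indicator_const 2
    ((measurableSet_cell i).prod (measurableSet_cell j)) _ (.inr (measure_ne_top _ _))

theorem integral_stepFun (u : Fin N → ℝ) : ∫ x, stepFun u x = 1 / (N : ℝ) * ∑ i, u i := by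
  simp only [stepFun_eq_sum_indicator]
  rw [integral_finsetSum _ fun i _ => (integrable_const _).indicator (measurableSet_cell i),
    Finset.mul_sum]
  refine Finset.sum_congr rfl fun i _ => ?_
  rw [integral_indicator_const _ (measurableSet_cell i), volume_real_cell, smul_eq_mul]

theorem integral_stepGraphon (W : Matrix (Fin N) (Fin N) ℝ) (x : I) :
    ∫ y, stepGraphon W x y = stepFun (fun i => 1 / (N : ℝ) * ∑ j, W i j) x := by
  rcases stepFun_zero_or_apply (N := N) x with hx | ⟨i, hx⟩
  · simp [stepGraphon, hx]
  · simp only [stepGraphon, hx, integral_stepFun]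

theorem graphonOp_stepGraphon (W : Matrix (Fin N) (Fin N) ℝ) (u : Fin N → ℝ) :
    graphonOp (stepGraphon W) (stepFun u) =
      stepFun fun i => 1 / (N : ℝ) * ∑ j, W i j * u j := by
  have hmul : ∀ x y, stepGraphon W x y * stepFun u y =
      stepGraphon (.of fun i j => W i j * u j) x y := fun x y => by
    rcases stepFun_zero_or_apply (N := N) x with hx | ⟨i, hx⟩ <;>
      rcases stepFun_zero_or_apply (N := N) y with hy | ⟨j, hy⟩ <;>
      simp [stepGraphon, hx, hy]
  funext x
  simp only [graphonOp, hmul, integral_stepGraphon, Matrix.of_apply]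

theorem graphonNorm_stepGraphon_sq (W : Matrix (Fin N) (Fin N) ℝ) :
    graphonNorm (stepGraphon W) ^ 2 = (1 / (N : ℝ)) ^ 2 * ∑ i, ∑ j, W i j ^ 2 := by
  have hsq : ∀ x y, stepGraphon W x y ^ 2 = stepGraphon (.of fun i j => W i j ^ 2) x y :=
    fun x y => by
      rcases stepFun_zero_or_apply (N := N) x with hx | ⟨i, hx⟩ <;>
        rcases stepFun_zero_or_apply (N := N) y with hy | ⟨j, hy⟩ <;>
        simp [stepGraphon, hx, hy]
  rw [graphonNorm_sq, Measure.volume_eq_prod,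
    integral_prod _ (isL2Kernel_stepGraphon W).integrable_sq_prod]
  simp only [hsq, integral_stepGraphon, integral_stepFun, ← Finset.mul_sum, Matrix.of_apply]
  ring

/-- The step function `ψ^N(u)` as an element of `L²(I)`. -/
def stepLp (u : Fin N → ℝ) : L²I := (memLp_stepFun u).toLp _

theorem coeFn_stepLp (u : Fin N → ℝ) : stepLp u =ᵐ[volume] stepFun u :=
  (memLp_stepFun u).coeFn_toLp

theorem stepLp_sub (u v : Fin N → ℝ) : stepLp u - stepLp v = stepLp (u - v) := by
  rw [stepLp, stepLp, stepLp, ← MemLp.toLp_sub]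
  congr 1
  funext x
  rcases stepFun_zero_or_apply (N := N) x with hx | ⟨i, hx⟩ <;> simp [hx]

theorem norm_stepLp_sq (u : Fin N → ℝ) : ‖stepLp u‖ ^ 2 = 1 / (N : ℝ) * ∑ i, u i ^ 2 := by
  rw [stepLp, norm_toLp_sq, ← integral_stepFun]
  congr 1
  funext x
  rcases stepFun_zero_or_apply (N := N) x with hx | ⟨i, hx⟩ <;> simp [hx]

theorem norm_stepLp_le {u : Fin N → ℝ} {c : ℝ} (hc : 0 ≤ c) (h : ∀ i, |u i| ≤ c) :
    ‖stepLp u‖ ≤ c := by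
  have hbound : ∀ᵐ x, ‖stepLp u x‖ ≤ c := (coeFn_stepLp u).mono fun x hx => by
    rw [hx, Real.norm_eq_abs]
    rcases stepFun_zero_or_apply (N := N) x with h₀ | ⟨i, hi⟩
    · rwa [h₀, abs_zero]
    · exact hi u ▸ h i
  simpa [measureUnivNNReal] using Lp.norm_le_of_ae_bound hc hbound

theorem norm_stepLp_le_mul {u v : Fin N → ℝ} {c : ℝ} (h : ∀ i, |u i| ≤ c * |v i|) :
    ‖stepLp u‖ ≤ c * ‖stepLp v‖ := by
  refine Lp.norm_le_mul_norm_of_ae_le_mul ?_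
  filter_upwards [coeFn_stepLp u, coeFn_stepLp v] with x hu hv
  rw [hu, hv, Real.norm_eq_abs, Real.norm_eq_abs]
  rcases stepFun_zero_or_apply (N := N) x with h₀ | ⟨i, hi⟩
  · rw [h₀, h₀, abs_zero, mul_zero]
  · exact hi u ▸ hi v ▸ h i

theorem toCLM_stepGraphon_stepLp (W : Matrix (Fin N) (Fin N) ℝ) (u : Fin N → ℝ) :
    (isL2Kernel_stepGraphon W).toCLM (stepLp u) =
      stepLp fun i => 1 / (N : ℝ) * ∑ j, W i j * u j :=
  Lp.ext <| ((isL2Kernel_stepGraphon W).coeFn_toCLM (coeFn_stepLp u)).trans <|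
    graphonOp_stepGraphon W u ▸ (coeFn_stepLp _).symm

theorem compLipschitz_stepLp (hN : 0 < N) {K : ℝ≥0} {h : ℝ → ℝ} (hh : LipschitzWith K h)
    (u : Fin N → ℝ) : compLipschitz hh (stepLp u) = stepLp fun i => h (u i) := by
  refine Lp.ext ?_
  filter_upwards [coeFn_compLipschitz hh (stepLp u), coeFn_stepLp u,
    coeFn_stepLp fun i => h (u i), ae_exists_stepFun_eq_apply hN] with x h₁ h₂ h₃ ⟨i, hi⟩
  rw [h₁, h₂, h₃, hi, hi]

theorem distS_stepFun_le (u : Fin N → ℝ) (g : L²I) (φ : MPEquiv) :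
    distS (stepFun u) g ≤ ‖φ.relabel (stepLp u) - g‖ := by
  refine (distS_le _ _ φ).trans_eq ?_
  rw [normL2, Lp.norm_def]
  refine congrArg ENNReal.toReal (eLpNorm_congr_ae ?_)
  filter_upwards [φ.coeFn_relabel (coeFn_stepLp u), Lp.coeFn_sub (φ.relabel (stepLp u)) g]
    with x h₁ h₂
  rw [h₂, Pi.sub_apply, h₁, Function.comp_apply]

end Step

/-! ### Interaction through a matrix -/

section Interaction

variable {N : ℕ} {E : Type*}

theorem lipschitzWith_toLp_map [NormedAddCommGroup E] {K : ℝ≥0}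
    {G : Fin N → E → E} (hG : ∀ j, LipschitzWith K (G j)) :
    LipschitzWith K fun z : PiLp 2 (fun _ : Fin N => E) => WithLp.toLp 2 fun j => G j (z j) := by
  refine LipschitzWith.of_dist_le_mul fun z z' => ?_
  rw [PiLp.dist_eq_of_L2, PiLp.dist_eq_of_L2, ← Real.sqrt_sq K.coe_nonneg,
    ← Real.sqrt_mul (sq_nonneg _), Finset.mul_sum]
  refine Real.sqrt_le_sqrt (Finset.sum_le_sum fun j _ => ?_)
  rw [← mul_pow]
  exact pow_le_pow_left₀ dist_nonneg ((hG j).dist_le_mul _ _) 2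

section Normed

variable [NormedAddCommGroup E] [NormedSpace ℝ E]

/-- The operator `u ↦ ((1/N) ∑_j W_{ij} u_j)_i` on `E^N` with its `ℓ²` norm. The game uses it with
`E = ℝ`, for deterministic aggregates, and with `E = L²(Ω)`. -/
def interactionCLM (W : Matrix (Fin N) (Fin N) ℝ) :
    PiLp 2 (fun _ : Fin N => E) →L[ℝ] PiLp 2 (fun _ : Fin N => E) :=
  (PiLp.continuousLinearEquiv 2 ℝ fun _ : Fin N => E).symm ∘L
    ContinuousLinearMap.pi fun i => (1 / (N : ℝ)) • ∑ j, W i j • PiLp.proj 2 (fun _ => E) j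

theorem interactionCLM_apply (W : Matrix (Fin N) (Fin N) ℝ) (u : PiLp 2 fun _ : Fin N => E)
    (i : Fin N) : interactionCLM W u i = (1 / (N : ℝ)) • ∑ j, W i j • u j := by
  simp [interactionCLM]

/-- The normalized `ℓ²` norm of the `i`-th column of `W`: the weight with which player `i` acts on
the whole population. -/
def columnNorm (W : Matrix (Fin N) (Fin N) ℝ) (i : Fin N) : ℝ := 1 / (N : ℝ) * √(∑ k, W k i ^ 2)

theorem columnNorm_nonneg (W : Matrix (Fin N) (Fin N) ℝ) (i : Fin N) : 0 ≤ columnNorm W i := by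
  unfold columnNorm
  positivity

theorem sum_columnNorm_sq (W : Matrix (Fin N) (Fin N) ℝ) :
    ∑ i, columnNorm W i ^ 2 = graphonNorm (stepGraphon W) ^ 2 := by
  simp only [columnNorm, mul_pow, graphonNorm_stepGraphon_sq]
  rw [← Finset.mul_sum, Finset.sum_comm]
  simp only [Real.sq_sqrt (Finset.sum_nonneg fun _ _ => sq_nonneg _)]

theorem norm_interactionCLM_single (W : Matrix (Fin N) (Fin N) ℝ) (i : Fin N) (x : E) :
    ‖interactionCLM W (WithLp.toLp 2 (Pi.single i x))‖ = columnNorm W i * ‖x‖ := by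
  have happly : ∀ k, ‖interactionCLM W (WithLp.toLp 2 (Pi.single i x)) k‖ ^ 2 =
      (1 / (N : ℝ) * ‖x‖) ^ 2 * W k i ^ 2 := fun k => by
    rw [interactionCLM_apply, Fintype.sum_eq_single i fun j hj => by simp [hj], PiLp.toLp_apply,
      Pi.single_eq_same, norm_smul, norm_smul, mul_pow, mul_pow, mul_pow, Real.norm_eq_abs,
      Real.norm_eq_abs, sq_abs, sq_abs]
    ring
  rw [PiLp.norm_eq_of_L2, Finset.sum_congr rfl fun k _ => happly k, ← Finset.mul_sum,
    Real.sqrt_mul (sq_nonneg _), Real.sqrt_sq (by positivity), columnNorm]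
  ring

end Normed

theorem sum_interaction_sq_le (W : Matrix (Fin N) (Fin N) ℝ) (u : Fin N → ℝ) :
    ∑ i, (1 / (N : ℝ) * ∑ j, W i j * u j) ^ 2 ≤
      ‖(isL2Kernel_stepGraphon W).toCLM‖ ^ 2 * ∑ j, u j ^ 2 := by
  rcases N.eq_zero_or_pos with rfl | hN
  · simp
  have hN' : (0 : ℝ) < 1 / N := by positivity
  have hop := pow_le_pow_left₀ (norm_nonneg _)
    ((isL2Kernel_stepGraphon W).toCLM.le_opNorm (stepLp u)) 2
  rw [toCLM_stepGraphon_stepLp, mul_pow, norm_stepLp_sq, norm_stepLp_sq, mul_left_comm] at hop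
  exact le_of_mul_le_mul_left hop hN'

variable [NormedAddCommGroup E] [InnerProductSpace ℝ E]

/-- Expand in an orthonormal basis, and use the scalar bound in every coordinate. -/
theorem norm_interactionCLM_apply_le_of_finiteDimensional [FiniteDimensional ℝ E]
    (W : Matrix (Fin N) (Fin N) ℝ) (u : PiLp 2 fun _ : Fin N => E) :
    ‖interactionCLM W u‖ ≤ ‖(isL2Kernel_stepGraphon W).toCLM‖ * ‖u‖ := by
  let e := stdOrthonormalBasis ℝ E
  have hcoord : ∀ i k, inner ℝ (e k) (interactionCLM W u i) =
      1 / (N : ℝ) * ∑ j, W i j * inner ℝ (e k) (u j) := fun i k => by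
    simp only [interactionCLM_apply, inner_smul_right, inner_sum]
  refine le_of_sq_le_sq ?_ (by positivity)
  rw [mul_pow, PiLp.norm_sq_eq_of_L2, PiLp.norm_sq_eq_of_L2]
  simp only [← e.sum_sq_norm_inner_right, Real.norm_eq_abs, sq_abs, hcoord]
  rw [Finset.sum_comm, Finset.sum_comm (γ := Fin N), Finset.mul_sum]
  exact Finset.sum_le_sum fun k _ => sum_interaction_sq_le W _

theorem norm_interactionCLM_le (W : Matrix (Fin N) (Fin N) ℝ) :
    ‖(interactionCLM W : PiLp 2 (fun _ : Fin N => E) →L[ℝ] _)‖ ≤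
      ‖(isL2Kernel_stepGraphon W).toCLM‖ := by
  refine ContinuousLinearMap.opNorm_le_bound _ (norm_nonneg _) fun u => ?_
  let S : Submodule ℝ E := Submodule.span ℝ (Set.range u)
  have : FiniteDimensional ℝ S := FiniteDimensional.span_of_finite ℝ (Set.finite_range u)
  let v : PiLp 2 fun _ : Fin N => S :=
    WithLp.toLp 2 fun j => ⟨u j, Submodule.subset_span (Set.mem_range_self j)⟩
  have hv : ∀ i, ((interactionCLM W v i : S) : E) = interactionCLM W u i := fun i => by
    simp [interactionCLM_apply, v]
  have h := norm_interactionCLM_apply_le_of_finiteDimensional W v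
  rw [PiLp.norm_eq_of_L2, PiLp.norm_eq_of_L2] at h ⊢
  simpa only [Submodule.coe_norm, hv] using h

theorem norm_sum_smul_sq_of_orthogonal {ι : Type*} [Fintype ι] {X : ι → E}
    (horth : Pairwise fun i j => inner ℝ (X i) (X j) = 0) (c : ι → ℝ) :
    ‖∑ j, c j • X j‖ ^ 2 = ∑ j, c j ^ 2 * ‖X j‖ ^ 2 := by
  simp only [← real_inner_self_eq_norm_sq, sum_inner, inner_sum, inner_smul_left, inner_smul_right,
    conj_trivial]
  refine Finset.sum_congr rfl fun i _ => ?_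
  rw [Fintype.sum_eq_single i fun j hj => by simp [horth hj]]
  ring

theorem norm_interactionCLM_of_orthogonal (W : Matrix (Fin N) (Fin N) ℝ)
    {X : PiLp 2 fun _ : Fin N => E} {s : ℝ} (hs₀ : 0 ≤ s) (hs : ∀ j, ‖X j‖ = s)
    (horth : Pairwise fun i j => inner ℝ (X i) (X j) = 0) :
    ‖interactionCLM W X‖ = s * graphonNorm (stepGraphon W) := by
  have hrow : ∀ i, ‖interactionCLM W X i‖ ^ 2 = (1 / (N : ℝ)) ^ 2 * s ^ 2 * ∑ j, W i j ^ 2 :=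
    fun i => by
      rw [interactionCLM_apply, norm_smul, mul_pow, Real.norm_eq_abs, sq_abs,
        norm_sum_smul_sq_of_orthogonal horth]
      simp only [hs, ← Finset.sum_mul]
      ring
  refine (sq_eq_sq₀ (norm_nonneg _) (mul_nonneg hs₀ (graphonNorm_nonneg _))).1 ?_
  rw [PiLp.norm_sq_eq_of_L2, Finset.sum_congr rfl fun i _ => hrow i, ← Finset.mul_sum, mul_pow,
    graphonNorm_stepGraphon_sq]
  ring

theorem contractingWith_interaction {K ρ : ℝ≥0} {G : Fin N → E → E}
    (W : Matrix (Fin N) (Fin N) ℝ) (hG : ∀ j, LipschitzWith K (G j))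
    (hρ : ‖(isL2Kernel_stepGraphon W).toCLM‖ * K ≤ ρ) (hρ1 : ρ < 1) :
    ContractingWith ρ
      (interactionCLM W ∘
        fun z : PiLp 2 (fun _ : Fin N => E) => WithLp.toLp 2 fun j => G j (z j)) :=
  contractingWith_clm_comp (lipschitzWith_toLp_map hG)
    ((mul_le_mul_of_nonneg_right (norm_interactionCLM_le W) K.coe_nonneg).trans hρ) hρ1

end Interaction

/-! ### Costs of random aggregates -/

section ExpectedCost

variable {Ω : Type*} [MeasurableSpace Ω] {P : Measure Ω} {μ₀ : Measure ℝ} {ξ : Ω → ℝ}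
  {A : Set ℝ} {b : ℝ → ℝ → ℝ} {f : ℝ → ℝ → ℝ → ℝ} {lJt α : ℝ}

/-- The expected cost of the action `α` for a player with shock `ξ` who faces the random
aggregate `x`. -/
def expectedCost (b : ℝ → ℝ → ℝ) (f : ℝ → ℝ → ℝ → ℝ) (P : Measure Ω) (ξ : Ω → ℝ) (α : ℝ)
    (x : Ω → ℝ) : ℝ :=
  ∫ ω, f (b α (x ω) + ξ ω) α (x ω) ∂P

theorem aemeasurable_prodMk_Lp (hξ : AEMeasurable ξ P) (x : Lp ℝ 2 P) :
    AEMeasurable (fun ω => (ξ ω, x ω)) P :=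
  hξ.prodMk (Lp.aestronglyMeasurable x).aemeasurable

theorem lintegral_ofReal_sub_sq (x y : Lp ℝ 2 P) :
    ∫⁻ ω, ENNReal.ofReal ((x ω - y ω) ^ 2) ∂P = ENNReal.ofReal (‖x - y‖ ^ 2) := by
  have hxy : MemLp (x - y : Ω → ℝ) 2 P := (Lp.memLp x).sub (Lp.memLp y)
  have hsub : x - y = hxy.toLp _ := by
    rw [MemLp.toLp_sub (Lp.memLp x) (Lp.memLp y), Lp.toLp_coeFn, Lp.toLp_coeFn]
  rw [hsub, norm_toLp_sq, ofReal_integral_eq_lintegral_ofReal hxy.integrable_sq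
    (.of_forall fun _ => sq_nonneg _)]
  rfl

/-- The joint law of `(ξ, x)` and `(ξ, y)` is a coupling that does not move the shock. -/
theorem wasserstein2_map_prodMk_le (hξ : AEMeasurable ξ P) (x y : Lp ℝ 2 P) :
    wasserstein2 (P.map fun ω => (ξ ω, x ω)) (P.map fun ω => (ξ ω, y ω)) ≤ ‖x - y‖ := by
  have hx := aemeasurable_prodMk_Lp hξ x
  have hy := aemeasurable_prodMk_Lp hξ y
  let π := P.map fun ω => ((ξ ω, x ω), (ξ ω, y ω))
  have hcoupling : π.map Prod.fst = P.map (fun ω => (ξ ω, x ω)) ∧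
      π.map Prod.snd = P.map fun ω => (ξ ω, y ω) :=
    ⟨AEMeasurable.map_map_of_aemeasurable measurable_fst.aemeasurable (hx.prodMk hy),
      AEMeasurable.map_map_of_aemeasurable measurable_snd.aemeasurable (hx.prodMk hy)⟩
  refine Real.sqrt_le_iff.2
    ⟨norm_nonneg _, ENNReal.toReal_le_of_le_ofReal (sq_nonneg _) ?_⟩
  refine (iInf₂_le π hcoupling).trans_eq ?_
  rw [lintegral_map' (by fun_prop) (hx.prodMk hy), ← lintegral_ofReal_sub_sq]
  simp

variable [IsProbabilityMeasure P]

theorem map_prodMk_mem_shockAggregateLaws (hξ : HasLaw ξ μ₀ P) (x : Lp ℝ 2 P) :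
    P.map (fun ω => (ξ ω, x ω)) ∈ ShockAggregateLaws μ₀ := by
  have hmeas := aemeasurable_prodMk_Lp hξ.aemeasurable x
  refine ⟨Measure.isProbabilityMeasure_map hmeas, ?_, ?_⟩
  · rw [AEMeasurable.map_map_of_aemeasurable measurable_fst.aemeasurable hmeas, ← hξ.map_eq]
    rfl
  · rw [memLp_map_measure_iff measurable_snd.aestronglyMeasurable hmeas]
    exact Lp.memLp x

theorem CostIntegrable.costLaw_map_prodMk (hf : CostIntegrable A b f μ₀) (hξ : HasLaw ξ μ₀ P)
    (hα : α ∈ A) (x : Lp ℝ 2 P) :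
    costLaw b f α (P.map fun ω => (ξ ω, x ω)) = expectedCost b f P ξ α x := by
  rw [costLaw, expectedCost, integral_map (aemeasurable_prodMk_Lp hξ.aemeasurable x)
    (hf α hα _ (map_prodMk_mem_shockAggregateLaws hξ x)).aestronglyMeasurable]

theorem CostLawLipschitz.abs_expectedCost_sub_le (hJt : CostLawLipschitz A b f μ₀ lJt)
    (hf : CostIntegrable A b f μ₀) (hξ : HasLaw ξ μ₀ P) (hα : α ∈ A) (x y : Lp ℝ 2 P) :
    |expectedCost b f P ξ α y - expectedCost b f P ξ α x| ≤ |lJt| * ‖x - y‖ := by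
  rw [← hf.costLaw_map_prodMk hξ hα x, ← hf.costLaw_map_prodMk hξ hα y]
  refine (hJt α hα _ (map_prodMk_mem_shockAggregateLaws hξ x) _
    (map_prodMk_mem_shockAggregateLaws hξ y)).trans ?_
  exact mul_le_mul (le_abs_self _) (wasserstein2_map_prodMk_le hξ.aemeasurable x y)
    (Real.sqrt_nonneg _) (abs_nonneg _)

theorem CostIntegrable.expectedCost_const (hf : CostIntegrable A b f μ₀) (hξ : HasLaw ξ μ₀ P)
    (hα : α ∈ A) (z : ℝ) : expectedCost b f P ξ α (Lp.const 2 P z) = cost b f μ₀ α z := by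
  have hlaw : (P.map fun ω => (ξ ω, Lp.const 2 P z ω)) = μ₀.map fun t => (t, z) := by
    rw [← hξ.map_eq, AEMeasurable.map_map_of_aemeasurable (by fun_prop) hξ.aemeasurable]
    exact Measure.map_congr (.of_forall fun ω => by simp)
  have hint := hf α hα _ (map_prodMk_mem_shockAggregateLaws hξ (Lp.const 2 P z))
  rw [← hf.costLaw_map_prodMk hξ hα, hlaw, costLaw,
    integral_map (by fun_prop) (hlaw ▸ hint.aestronglyMeasurable)]
  rfl

end ExpectedCost

/-! ### Aggregates of the finite game -/

section Aggregate

variable {N : ℕ} {Ω : Type*} [MeasurableSpace Ω] {P : Measure Ω} {μ₀ : Measure ℝ}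
  {ξ : Fin N → Ω → ℝ}

theorem memLp_of_hasLaw (hμ₀ : CenteredSquareIntegrable μ₀) {η : Ω → ℝ} (hη : HasLaw η μ₀ P) :
    MemLp η 2 P := by
  have hid := hμ₀.1
  rwa [← hη.map_eq, memLp_map_measure_iff aestronglyMeasurable_id hη.aemeasurable] at hid

/-- The shocks as an element of `L²(Ω)^N`. -/
def shockLp (hξ : ∀ j, MemLp (ξ j) 2 P) : PiLp 2 fun _ : Fin N => Lp ℝ 2 P :=
  WithLp.toLp 2 fun j => (hξ j).toLp (ξ j)

theorem coeFn_shockLp (hξ : ∀ j, MemLp (ξ j) 2 P) (j : Fin N) : shockLp hξ j =ᵐ[P] ξ j :=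
  (hξ j).coeFn_toLp

theorem norm_shockLp (hξ : ∀ j, MemLp (ξ j) 2 P) (hlaw : ∀ j, HasLaw (ξ j) μ₀ P) (j : Fin N) :
    ‖shockLp hξ j‖ = √(∫ t, t ^ 2 ∂μ₀) := by
  rw [← (hlaw j).integral_comp (f := fun t : ℝ => t ^ 2) (by fun_prop)]
  exact (Real.sqrt_sq (norm_nonneg _)).symm.trans (congrArg _ (norm_toLp_sq (hξ j)))

theorem inner_shockLp (hξ : ∀ j, MemLp (ξ j) 2 P) (hmean : ∀ j, ∫ ω, ξ j ω ∂P = 0)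
    (hind : Pairwise fun i j => IndepFun (ξ i) (ξ j) P) :
    Pairwise fun i j => inner ℝ (shockLp hξ i) (shockLp hξ j) = 0 := fun i j hij => by
  have hmul := (hind hij).integral_mul_eq_mul_integral (hξ i).1 (hξ j).1
  rw [hmean i, zero_mul] at hmul
  exact (inner_toLp (hξ i) (hξ j)).trans hmul

variable {A : Set ℝ} {b : ℝ → ℝ → ℝ} {cα cz c₀ : ℝ} {W : Matrix (Fin N) (Fin N) ℝ}
  {α : Fin N → ℝ} {ρ : ℝ≥0}

section AggregateMap

variable [IsFiniteMeasure P]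

/-- The map of `L²(Ω)^N` whose fixed points are the aggregates of the profile `α`, for shocks
`X`. -/
def aggregateMap (hb : LipschitzDrift A b cα cz) (hα : ∀ j, α j ∈ A)
    (W : Matrix (Fin N) (Fin N) ℝ) (X : PiLp 2 fun _ : Fin N => Lp ℝ 2 P) :
    PiLp 2 (fun _ : Fin N => Lp ℝ 2 P) → PiLp 2 fun _ : Fin N => Lp ℝ 2 P :=
  interactionCLM W ∘ fun z =>
    WithLp.toLp 2 fun j => compLipschitz (hb.lipschitzWith (hα j)) (z j) + X j

theorem coeFn_aggregateMap (hb : LipschitzDrift A b cα cz) (hα : ∀ j, α j ∈ A)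
    (W : Matrix (Fin N) (Fin N) ℝ) {X : PiLp 2 fun _ : Fin N => Lp ℝ 2 P}
    (hX : ∀ j, X j =ᵐ[P] ξ j) (z : PiLp 2 fun _ : Fin N => Lp ℝ 2 P) (i : Fin N) :
    aggregateMap hb hα W X z i =ᵐ[P]
      fun ω => 1 / (N : ℝ) * ∑ j, W i j * (b (α j) (z j ω) + ξ j ω) := by
  let y : Fin N → Lp ℝ 2 P := fun j => compLipschitz (hb.lipschitzWith (hα j)) (z j) + X j
  have hterm : ∀ᵐ ω ∂P, ∀ j, (W i j • y j : Lp ℝ 2 P) ω =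
      W i j * (b (α j) (z j ω) + ξ j ω) := ae_all_iff.2 fun j => by
    filter_upwards [Lp.coeFn_smul (W i j) (y j), Lp.coeFn_add _ (X j), hX j,
      coeFn_compLipschitz (hb.lipschitzWith (hα j)) (z j)] with ω h₁ h₂ h₃ h₄
    rw [h₁, Pi.smul_apply, h₂, Pi.add_apply, h₃, h₄, smul_eq_mul]
  have hmap : aggregateMap hb hα W X z i = (1 / (N : ℝ)) • ∑ j, W i j • y j :=
    interactionCLM_apply W _ i
  rw [hmap]
  filter_upwards [hterm, Lp.coeFn_smul (1 / (N : ℝ)) (∑ j, W i j • y j),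
    Lp.coeFn_finsetSum Finset.univ fun j => W i j • y j] with ω h₁ h₂ h₃
  rw [h₂, Pi.smul_apply, h₃, smul_eq_mul, Finset.sum_apply]
  simp only [h₁]

theorem isAggregate_iff (hb : LipschitzDrift A b cα cz) (hα : ∀ j, α j ∈ A)
    {X : PiLp 2 fun _ : Fin N => Lp ℝ 2 P} (hX : ∀ j, X j =ᵐ[P] ξ j) (z : Fin N → Lp ℝ 2 P) :
    IsAggregate b P ξ W α z ↔
      Function.IsFixedPt (aggregateMap hb hα W X) (WithLp.toLp 2 z) := by
  have hcoe := coeFn_aggregateMap hb hα W hX (WithLp.toLp 2 z)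
  refine ⟨fun h => PiLp.ext fun i => Lp.ext ((hcoe i).trans (h i).symm), fun h i => ?_⟩
  simpa only [h.eq] using hcoe i

theorem contractingWith_aggregateMap (hb : LipschitzDrift A b cα cz) (hα : ∀ j, α j ∈ A)
    (X : PiLp 2 fun _ : Fin N => Lp ℝ 2 P)
    (hρ : ‖(isL2Kernel_stepGraphon W).toCLM‖ * √cz ≤ ρ) (hρ1 : ρ < 1) :
    ContractingWith ρ (aggregateMap hb hα W X) :=
  contractingWith_interaction (K := (√cz).toNNReal) W
    (G := fun j y => compLipschitz (hb.lipschitzWith (hα j)) y + X j)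
    (fun j => by
      simpa using (lipschitzWith_compLipschitz (hb.lipschitzWith (hα j))).add (.const (X j)))
    (by simpa using hρ) hρ1

theorem isFixedPt_aggregate (hb : LipschitzDrift A b cα cz) (hα : ∀ j, α j ∈ A)
    {X : PiLp 2 fun _ : Fin N => Lp ℝ 2 P} (hX : ∀ j, X j =ᵐ[P] ξ j)
    (hρ : ‖(isL2Kernel_stepGraphon W).toCLM‖ * √cz ≤ ρ) (hρ1 : ρ < 1) :
    Function.IsFixedPt (aggregateMap hb hα W X) (WithLp.toLp 2 (aggregate b P ξ W α)) := by
  have hfix := (contractingWith_aggregateMap hb hα X hρ hρ1).fixedPoint_isFixedPt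
  exact (isAggregate_iff hb hα hX _).1
    (Classical.epsilon_spec ⟨_, (isAggregate_iff hb hα hX (WithLp.ofLp _)).2 hfix⟩)

theorem aggregateMap_update_sub (hb : LipschitzDrift A b cα cz) (hα : ∀ j, α j ∈ A) {i : Fin N}
    {β : ℝ} (hβ : β ∈ A) (hα' : ∀ j, Function.update α i β j ∈ A)
    (X z : PiLp 2 fun _ : Fin N => Lp ℝ 2 P) :
    aggregateMap hb hα' W X z - aggregateMap hb hα W X z =
      interactionCLM W (WithLp.toLp 2 (Pi.single i (compLipschitz (hb.lipschitzWith hβ) (z i) -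
        compLipschitz (hb.lipschitzWith (hα i)) (z i)))) := by
  rw [aggregateMap, aggregateMap, Function.comp_apply, Function.comp_apply, ← map_sub]
  congr 1
  ext1 j
  rcases eq_or_ne j i with rfl | hj
  · simp
  · simp [hj]

/-- `zbar` solves the equation of the aggregates of the profile `α` with the shocks replaced by
their mean `0`. -/
def IsMeanAggregate (b : ℝ → ℝ → ℝ) (W : Matrix (Fin N) (Fin N) ℝ) (α zbar : Fin N → ℝ) : Prop :=
  ∀ i, zbar i = 1 / (N : ℝ) * ∑ j, W i j * b (α j) (zbar j)

theorem exists_isMeanAggregate (hb : LipschitzDrift A b cα cz) (hα : ∀ j, α j ∈ A)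
    (hρ : ‖(isL2Kernel_stepGraphon W).toCLM‖ * √cz ≤ ρ) (hρ1 : ρ < 1) :
    ∃ zbar, IsMeanAggregate b W α zbar := by
  have hcontr := contractingWith_interaction W (fun j => hb.lipschitzWith (hα j))
    (by simpa using hρ) hρ1
  exact ⟨_, fun i => (congrFun (congrArg WithLp.ofLp hcontr.fixedPoint_isFixedPt) i).symm.trans
    (interactionCLM_apply W _ i)⟩

theorem aggregateMap_const_sub (hb : LipschitzDrift A b cα cz) (hα : ∀ j, α j ∈ A)
    {zbar : Fin N → ℝ} (hzbar : IsMeanAggregate b W α zbar)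
    (X : PiLp 2 fun _ : Fin N => Lp ℝ 2 P) :
    aggregateMap hb hα W X (WithLp.toLp 2 fun i => Lp.const 2 P (zbar i)) -
      (WithLp.toLp 2 fun i => Lp.const 2 P (zbar i)) = interactionCLM W X := by
  have hconst : ∀ j, compLipschitz (hb.lipschitzWith (hα j)) (Lp.const 2 P (zbar j)) =
      Lp.constL 2 P ℝ (b (α j) (zbar j)) := fun j => by
    refine Lp.ext ((coeFn_compLipschitz _ _).trans ?_)
    filter_upwards [Lp.coeFn_const (p := 2) (μ := P) (zbar j),
      Lp.coeFn_const (p := 2) (μ := P) (b (α j) (zbar j))] with ω h₁ h₂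
    rw [h₁]
    exact h₂.symm
  ext1 i
  have hi : Lp.const 2 P (zbar i) =
      (1 / (N : ℝ)) • ∑ j, W i j • Lp.constL 2 P ℝ (b (α j) (zbar j)) := by
    simp only [← map_smul, ← map_sum, smul_eq_mul]
    exact congrArg _ (hzbar i)
  rw [PiLp.sub_apply, aggregateMap, Function.comp_apply, interactionCLM_apply,
    interactionCLM_apply, PiLp.toLp_apply, hi]
  simp only [hconst, smul_add, Finset.sum_add_distrib, add_sub_cancel_left]

end AggregateMap

variable [IsProbabilityMeasure P]

theorem BoundedDrift.norm_compLipschitz_sub_le (hb_bdd : BoundedDrift A b c₀)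
    (hb : LipschitzDrift A b cα cz) {β β' : ℝ} (hβ : β ∈ A) (hβ' : β' ∈ A) (x : Lp ℝ 2 P) :
    ‖compLipschitz (hb.lipschitzWith hβ) x - compLipschitz (hb.lipschitzWith hβ') x‖ ≤ 2 * c₀ := by
  refine (Lp.norm_le_of_ae_bound (C := 2 * c₀) (by linarith [hb_bdd.1]) ?_).trans_eq
    (by simp [measureUnivNNReal])
  filter_upwards [Lp.coeFn_sub (compLipschitz (hb.lipschitzWith hβ) x)
    (compLipschitz (hb.lipschitzWith hβ') x), coeFn_compLipschitz (hb.lipschitzWith hβ) x,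
    coeFn_compLipschitz (hb.lipschitzWith hβ') x] with ω h₁ h₂ h₃
  rw [h₁, Pi.sub_apply, h₂, h₃]
  exact (norm_sub_le _ _).trans
    (by linarith [hb_bdd.2 β hβ (x ω), hb_bdd.2 β' hβ' (x ω), Real.norm_eq_abs (b β (x ω)),
      Real.norm_eq_abs (b β' (x ω))])

theorem norm_aggregate_update_sub_le (hb : LipschitzDrift A b cα cz)
    (hb_bdd : BoundedDrift A b c₀) (hξ : ∀ j, MemLp (ξ j) 2 P)
    (hρ : ‖(isL2Kernel_stepGraphon W).toCLM‖ * √cz ≤ ρ) (hρ1 : ρ < 1) (hα : ∀ j, α j ∈ A)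
    (i : Fin N) {β : ℝ} (hβ : β ∈ A) :
    ‖aggregate b P ξ W (Function.update α i β) i - aggregate b P ξ W α i‖ ≤
      2 * c₀ / (1 - ρ) * columnNorm W i := by
  have hα' : ∀ j, Function.update α i β j ∈ A := fun j => by
    rcases eq_or_ne j i with rfl | hj
    · simpa using hβ
    · simpa [hj] using hα j
  have hX := coeFn_shockLp hξ
  let z : PiLp 2 fun _ : Fin N => Lp ℝ 2 P := WithLp.toLp 2 (aggregate b P ξ W α)
  have hz : aggregateMap hb hα W (shockLp hξ) z = z := isFixedPt_aggregate hb hα hX hρ hρ1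
  have hdist := (contractingWith_aggregateMap hb hα' (shockLp hξ) hρ hρ1).dist_le_of_fixedPoint z
    (isFixedPt_aggregate hb hα' hX hρ hρ1)
  rw [dist_comm, dist_eq_norm, dist_comm, dist_eq_norm] at hdist
  nth_rw 3 [← hz] at hdist
  rw [aggregateMap_update_sub hb hα hβ hα', norm_interactionCLM_single] at hdist
  calc ‖aggregate b P ξ W (Function.update α i β) i - aggregate b P ξ W α i‖
      ≤ ‖WithLp.toLp 2 (aggregate b P ξ W (Function.update α i β)) - z‖ :=
        PiLp.norm_apply_le (WithLp.toLp 2 (aggregate b P ξ W (Function.update α i β)) - z) i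
    _ ≤ columnNorm W i * (2 * c₀) / (1 - ρ) := hdist.trans <| by
        have : (0 : ℝ) < 1 - ρ := sub_pos.2 hρ1
        gcongr
        · exact columnNorm_nonneg W i
        · exact hb_bdd.norm_compLipschitz_sub_le hb hβ (hα i) (z i)
    _ = 2 * c₀ / (1 - ρ) * columnNorm W i := by ring

/-- The shocks are orthogonal in `L²(Ω)`, so they average out. -/
theorem norm_aggregate_sub_const_le (hμ₀ : CenteredSquareIntegrable μ₀)
    (hlaw : ∀ j, HasLaw (ξ j) μ₀ P) (hind : Pairwise fun i j => IndepFun (ξ i) (ξ j) P)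
    (hb : LipschitzDrift A b cα cz) (hρ : ‖(isL2Kernel_stepGraphon W).toCLM‖ * √cz ≤ ρ)
    (hρ1 : ρ < 1) (hα : ∀ j, α j ∈ A) {zbar : Fin N → ℝ} (hzbar : IsMeanAggregate b W α zbar) :
    ‖(WithLp.toLp 2 fun i => aggregate b P ξ W α i - Lp.const 2 P (zbar i) :
        PiLp 2 fun _ : Fin N => Lp ℝ 2 P)‖ ≤
      √(∫ t, t ^ 2 ∂μ₀) / (1 - ρ) * graphonNorm (stepGraphon W) := by
  have hξ : ∀ j, MemLp (ξ j) 2 P := fun j => memLp_of_hasLaw hμ₀ (hlaw j)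
  have hmean : ∀ j, ∫ ω, ξ j ω ∂P = 0 := fun j => (hlaw j).integral_eq.trans hμ₀.2
  have hdist := (contractingWith_aggregateMap hb hα (shockLp hξ) hρ hρ1).dist_le_of_fixedPoint
    (WithLp.toLp 2 fun i => Lp.const 2 P (zbar i))
    (isFixedPt_aggregate hb hα (coeFn_shockLp hξ) hρ hρ1)
  rw [dist_comm, dist_eq_norm, dist_comm, dist_eq_norm, aggregateMap_const_sub hb hα hzbar,
    norm_interactionCLM_of_orthogonal W (Real.sqrt_nonneg _) (norm_shockLp hξ hlaw)
      (inner_shockLp hξ hmean hind), mul_div_right_comm] at hdist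
  exact hdist

end Aggregate

/-! ### Equilibria of the finite game -/

theorem sum_norm_le_sqrt_mul_norm {N : ℕ} {E : Type*} [NormedAddCommGroup E]
    (u : PiLp 2 fun _ : Fin N => E) : ∑ i, ‖u i‖ ≤ √N * ‖u‖ := by
  rw [PiLp.norm_eq_of_L2, ← Real.sqrt_mul N.cast_nonneg]
  refine Real.le_sqrt_of_sq_le ?_
  simpa using sq_sum_le_card_mul_sum_sq (s := Finset.univ) (f := fun i => ‖u i‖)

theorem sum_columnNorm_le {N : ℕ} (W : Matrix (Fin N) (Fin N) ℝ) :
    ∑ i, columnNorm W i ≤ √N * graphonNorm (stepGraphon W) := by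
  have h := sum_norm_le_sqrt_mul_norm (WithLp.toLp 2 (columnNorm W))
  rw [PiLp.norm_eq_of_L2] at h
  simpa only [PiLp.toLp_apply, Real.norm_eq_abs, abs_of_nonneg (columnNorm_nonneg W _),
    sum_columnNorm_sq, Real.sqrt_sq (graphonNorm_nonneg _)] using h

section FiniteNash

variable {N : ℕ} {Ω : Type*} [MeasurableSpace Ω] {P : Measure Ω} [IsProbabilityMeasure P]
  {μ₀ : Measure ℝ} {ξ : Fin N → Ω → ℝ} {A : Set ℝ} {b : ℝ → ℝ → ℝ} {f : ℝ → ℝ → ℝ → ℝ}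
  {cα cz c₀ lc lJ lJt : ℝ} {a : ℝ → ℝ} {W : Matrix (Fin N) (Fin N) ℝ} {α : Fin N → ℝ} {ρ : ℝ≥0}

/-- Deviating to the best reply `a s` to a deterministic aggregate `s` gains at most what the
randomness of the aggregates can account for. -/
theorem IsNash.sq_sub_bestReply_le (hα : IsNash A b f P ξ W α) (hf : CostIntegrable A b f μ₀)
    (hJt : CostLawLipschitz A b f μ₀ lJt) (hJ : CostRegular A b f μ₀ lc lJ)
    (ha : IsBestReply A b f μ₀ a) {i : Fin N} (hξ : HasLaw (ξ i) μ₀ P) (s : ℝ) :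
    lc / 2 * (α i - a s) ^ 2 ≤ |lJt| * (2 * ‖aggregate b P ξ W α i - Lp.const 2 P s‖ +
      ‖aggregate b P ξ W (Function.update α i (a s)) i - aggregate b P ξ W α i‖) := by
  set z := aggregate b P ξ W α i
  set z' := aggregate b P ξ W (Function.update α i (a s)) i
  set c := Lp.const 2 P s
  have hβ := (ha s).1
  have hnash : expectedCost b f P (ξ i) (α i) z ≤ expectedCost b f P (ξ i) (a s) z' := by
    simpa only [playerCost, expectedCost, Function.update_self] using hα.2 i _ hβ
  have hcost : expectedCost b f P (ξ i) (a s) c + lc / 2 * (α i - a s) ^ 2 ≤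
      expectedCost b f P (ξ i) (α i) c := by
    rw [hf.expectedCost_const hξ hβ, hf.expectedCost_const hξ (hα.1 i)]
    exact hJ.cost_add_sq_le ha (hα.1 i) s
  have hdev := (neg_le_abs _).trans (hJt.abs_expectedCost_sub_le hf hξ hβ z' c)
  have hown := (le_abs_self _).trans (hJt.abs_expectedCost_sub_le hf hξ (hα.1 i) z c)
  have htri : |lJt| * ‖z' - c‖ ≤ |lJt| * (‖z' - z‖ + ‖z - c‖) :=
    mul_le_mul_of_nonneg_left (norm_sub_le_norm_sub_add_norm_sub z' z c) (abs_nonneg _)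
  linarith

theorem IsNash.sum_sq_sub_bestReply_le (hα : IsNash A b f P ξ W α)
    (hμ₀ : CenteredSquareIntegrable μ₀) (hlaw : ∀ j, HasLaw (ξ j) μ₀ P)
    (hind : Pairwise fun i j => IndepFun (ξ i) (ξ j) P) (hb : LipschitzDrift A b cα cz)
    (hb_bdd : BoundedDrift A b c₀) (hf : CostIntegrable A b f μ₀)
    (hJt : CostLawLipschitz A b f μ₀ lJt) (hJ : CostRegular A b f μ₀ lc lJ)
    (ha : IsBestReply A b f μ₀ a) (hρ : ‖(isL2Kernel_stepGraphon W).toCLM‖ * √cz ≤ ρ)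
    (hρ1 : ρ < 1) {zbar : Fin N → ℝ} (hzbar : IsMeanAggregate b W α zbar) :
    ∑ i, (α i - a (zbar i)) ^ 2 ≤
      2 * |lJt| / lc * ((2 * √(∫ t, t ^ 2 ∂μ₀) + 2 * c₀) / (1 - ρ)) *
        (√N * graphonNorm (stepGraphon W)) := by
  have hξ : ∀ j, MemLp (ξ j) 2 P := fun j => memLp_of_hasLaw hμ₀ (hlaw j)
  have hlc := hJ.1
  have hρ' : (0 : ℝ) < 1 - ρ := sub_pos.2 hρ1
  let d : PiLp 2 fun _ : Fin N => Lp ℝ 2 P :=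
    WithLp.toLp 2 fun i => aggregate b P ξ W α i - Lp.const 2 P (zbar i)
  have hplayer : ∀ i, (α i - a (zbar i)) ^ 2 ≤
      2 * |lJt| / lc * (2 * ‖d i‖ + 2 * c₀ / (1 - ρ) * columnNorm W i) := fun i => by
    have hdev := norm_aggregate_update_sub_le hb hb_bdd hξ hρ hρ1 hα.1 i (ha (zbar i)).1
    have hsq := (hα.sq_sub_bestReply_le hf hJt hJ ha (hlaw i) (zbar i)).trans
      (mul_le_mul_of_nonneg_left (add_le_add_right hdev _) (abs_nonneg _))
    rw [div_mul_eq_mul_div, le_div_iff₀ hlc]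
    linarith
  have hnoise : ∑ i, ‖d i‖ ≤
      √N * (√(∫ t, t ^ 2 ∂μ₀) / (1 - ρ) * graphonNorm (stepGraphon W)) :=
    (sum_norm_le_sqrt_mul_norm d).trans <| mul_le_mul_of_nonneg_left
      (norm_aggregate_sub_const_le hμ₀ hlaw hind hb hρ hρ1 hα.1 hzbar) (Real.sqrt_nonneg _)
  calc ∑ i, (α i - a (zbar i)) ^ 2
      ≤ ∑ i, 2 * |lJt| / lc * (2 * ‖d i‖ + 2 * c₀ / (1 - ρ) * columnNorm W i) :=
        Finset.sum_le_sum fun i _ => hplayer i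
    _ = 2 * |lJt| / lc * (2 * ∑ i, ‖d i‖ + 2 * c₀ / (1 - ρ) * ∑ i, columnNorm W i) := by
        rw [← Finset.mul_sum, Finset.sum_add_distrib, ← Finset.mul_sum, ← Finset.mul_sum]
    _ ≤ 2 * |lJt| / lc * (2 * (√N * (√(∫ t, t ^ 2 ∂μ₀) / (1 - ρ) * graphonNorm (stepGraphon W))) +
          2 * c₀ / (1 - ρ) * (√N * graphonNorm (stepGraphon W))) := by
        have := hb_bdd.1
        gcongr
        exact sum_columnNorm_le W
    _ = _ := by ring

theorem IsNash.norm_stepLp_sub_bestReply_le (hα : IsNash A b f P ξ W α)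
    (hμ₀ : CenteredSquareIntegrable μ₀) (hlaw : ∀ j, HasLaw (ξ j) μ₀ P)
    (hind : Pairwise fun i j => IndepFun (ξ i) (ξ j) P) (hb : LipschitzDrift A b cα cz)
    (hb_bdd : BoundedDrift A b c₀) (hf : CostIntegrable A b f μ₀)
    (hJt : CostLawLipschitz A b f μ₀ lJt) (hJ : CostRegular A b f μ₀ lc lJ)
    (ha : IsBestReply A b f μ₀ a) (hρ : ‖(isL2Kernel_stepGraphon W).toCLM‖ * √cz ≤ ρ)
    (hρ1 : ρ < 1) {zbar : Fin N → ℝ} (hzbar : IsMeanAggregate b W α zbar) :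
    ‖stepLp α - stepLp fun i => a (zbar i)‖ ≤
      √(2 * |lJt| / lc * ((2 * √(∫ t, t ^ 2 ∂μ₀) + 2 * c₀) / (1 - ρ)) *
        (graphonNorm (stepGraphon W) / √N)) := by
  refine Real.le_sqrt_of_sq_le ?_
  rw [stepLp_sub, norm_stepLp_sq, div_eq_mul_inv _ √(N : ℝ), ← Real.sqrt_div_self]
  refine (mul_le_mul_of_nonneg_left (hα.sum_sq_sub_bestReply_le hμ₀ hlaw hind hb hb_bdd hf hJt hJ
    ha hρ hρ1 hzbar) (by positivity)).trans_eq ?_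
  ring

end FiniteNash

/-! ### Convergence of the equilibria -/

section Comparison

variable {A : Set ℝ} {b : ℝ → ℝ → ℝ} {cα cz c₀ : ℝ} {a : ℝ → ℝ} {w : I → I → ℝ}
  {N : ℕ} {W : Matrix (Fin N) (Fin N) ℝ} {α zbar : Fin N → ℝ} {κ κ' θ : ℝ≥0}

/-- The relabelled mean aggregate nearly solves the equation `z = 𝐖 b(a(z), z)` of the limit
equilibrium; the defect splits into the errors made by replacing `W` by `w` and `α` by `a(z)`. -/
theorem IsMeanAggregate.dist_relabel_le (hzbar : IsMeanAggregate b W α zbar) (hN : 0 < N)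
    (hα : ∀ i, α i ∈ A) (hb : LipschitzDrift A b cα cz) (hb_bdd : BoundedDrift A b c₀)
    (haA : ∀ s, a s ∈ A) (hfb : LipschitzWith κ' fun s => b (a s) s) (hw : IsL2Kernel w)
    (φ : MPEquiv) :
    dist (φ.relabel (stepLp zbar)) ((hw.toCLM ∘ compLipschitz hfb) (φ.relabel (stepLp zbar))) ≤
      (graphonNorm fun x y => stepGraphon W (φ.1 x) (φ.1 y) - w x y) * c₀ +
        ‖hw.toCLM‖ * (√cα * ‖stepLp α - stepLp fun i => a (zbar i)‖) := by
  set hW := isL2Kernel_stepGraphon W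
  let u : Fin N → ℝ := fun i => b (α i) (zbar i)
  let v : Fin N → ℝ := fun i => b (a (zbar i)) (zbar i)
  have hfixed : stepLp zbar = hW.toCLM (stepLp u) :=
    (congrArg stepLp (funext hzbar)).trans (toCLM_stepGraphon_stepLp W u).symm
  have hsplit : φ.relabel (stepLp zbar) - hw.toCLM (φ.relabel (stepLp v)) =
      ((hW.relabel φ).toCLM - hw.toCLM) (φ.relabel (stepLp u)) +
        hw.toCLM (φ.relabel (stepLp u - stepLp v)) := by
    rw [hfixed, ← hW.toCLM_relabel φ, sub_apply, map_sub, map_sub]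
    abel
  have hu : ‖stepLp u‖ ≤ c₀ := norm_stepLp_le hb_bdd.1.le fun i => hb_bdd.2 _ (hα i) _
  have huv : ‖stepLp u - stepLp v‖ ≤ √cα * ‖stepLp α - stepLp fun i => a (zbar i)‖ := by
    rw [stepLp_sub, stepLp_sub]
    exact norm_stepLp_le_mul fun i => by
      simpa using hb.abs_sub_le (hα i) (haA (zbar i)) (zbar i) (zbar i)
  rw [Function.comp_apply, φ.compLipschitz_relabel, compLipschitz_stepLp hN, dist_eq_norm, hsplit]
  refine (norm_add_le _ _).trans (add_le_add ?_ ?_)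
  · refine (ContinuousLinearMap.le_opNorm _ _).trans ?_
    rw [φ.relabel.norm_map]
    gcongr
    exacts [graphonNorm_nonneg _, IsL2Kernel.norm_toCLM_sub_le (hW.relabel φ) hw]
  · refine (hw.toCLM.le_opNorm _).trans ?_
    rw [φ.relabel.norm_map]
    gcongr

theorem IsMeanAggregate.distS_stepFun_le (hzbar : IsMeanAggregate b W α zbar) (hN : 0 < N)
    (hα : ∀ i, α i ∈ A) (hb : LipschitzDrift A b cα cz) (hb_bdd : BoundedDrift A b c₀)
    (haA : ∀ s, a s ∈ A) (haL : LipschitzWith κ a) (hfb : LipschitzWith κ' fun s => b (a s) s)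
    (hw : IsL2Kernel w) (hcontr : ContractingWith θ (hw.toCLM ∘ compLipschitz hfb)) {zhat : L²I}
    (hzhat : Function.IsFixedPt (hw.toCLM ∘ compLipschitz hfb) zhat) (φ : MPEquiv) :
    distS (stepFun α) (compLipschitz haL zhat) ≤
      ‖stepLp α - stepLp fun i => a (zbar i)‖ +
        κ * (((graphonNorm fun x y => stepGraphon W (φ.1 x) (φ.1 y) - w x y) * c₀ +
          ‖hw.toCLM‖ * (√cα * ‖stepLp α - stepLp fun i => a (zbar i)‖)) / (1 - θ)) := by
  have haggregate := (hcontr.dist_le_of_fixedPoint _ hzhat).trans <| div_le_div_of_nonneg_right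
    (hzbar.dist_relabel_le hN hα hb hb_bdd haA hfb hw φ) (sub_nonneg.2 hcontr.1.le)
  have hreply := ((lipschitzWith_compLipschitz haL).dist_le_mul (φ.relabel (stepLp zbar)) zhat)
  rw [φ.compLipschitz_relabel, compLipschitz_stepLp hN, dist_eq_norm] at hreply
  refine (GraphonGame.distS_stepFun_le α _ φ).trans <|
    (norm_sub_le_norm_sub_add_norm_sub _ (φ.relabel (stepLp fun i => a (zbar i))) _).trans <|
    add_le_add ?_ (hreply.trans (mul_le_mul_of_nonneg_left haggregate κ.2))
  rw [← map_sub, φ.relabel.norm_map]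

end Comparison

section Convergence

variable {A : Set ℝ} {b : ℝ → ℝ → ℝ} {f : ℝ → ℝ → ℝ → ℝ} {μ₀ : Measure ℝ}
  {cα cz c₀ lc lJ lJt : ℝ} {a : ℝ → ℝ} {w : I → I → ℝ} {κ κ' θ : ℝ≥0}
  {Ω : ℕ → Type*} [∀ N, MeasurableSpace (Ω N)] {P : ∀ N, Measure (Ω N)}
  [∀ N, IsProbabilityMeasure (P N)] {ξ : ∀ N, Fin N → Ω N → ℝ}
  {W : ∀ N, Matrix (Fin N) (Fin N) ℝ} {α : ∀ N, Fin N → ℝ}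

theorem tendsto_distS_stepFun (hμ₀ : CenteredSquareIntegrable μ₀)
    (hb : LipschitzDrift A b cα cz) (hb_bdd : BoundedDrift A b c₀) (hf : CostIntegrable A b f μ₀)
    (hJt : CostLawLipschitz A b f μ₀ lJt) (hJ : CostRegular A b f μ₀ lc lJ)
    (hlaw : ∀ N i, HasLaw (ξ N i) μ₀ (P N))
    (hind : ∀ N, Pairwise fun i j => IndepFun (ξ N i) (ξ N j) (P N))
    (hα : ∀ᶠ N in atTop, IsNash A b f (P N) (ξ N) (W N) (α N)) (hw : IsL2Kernel w)
    (hcut : Tendsto (fun N => cutDist (stepGraphon (W N)) w) atTop (𝓝 0))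
    (hnorm : Tendsto (fun N => graphonNorm (stepGraphon (W N))) atTop (𝓝 (graphonNorm w)))
    (hsmall : ‖hw.toCLM‖ * √cz < 1) (ha : IsBestReply A b f μ₀ a) (haL : LipschitzWith κ a)
    (hfb : LipschitzWith κ' fun s => b (a s) s)
    (hcontr : ContractingWith θ (hw.toCLM ∘ compLipschitz hfb)) {zhat : L²I}
    (hzhat : Function.IsFixedPt (hw.toCLM ∘ compLipschitz hfb) zhat) :
    Tendsto (fun N => distS (stepFun (α N)) (compLipschitz haL zhat)) atTop (𝓝 0) := by
  obtain ⟨φ, hφ⟩ :=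
    exists_relabel_tendsto_graphonNorm_sub hw (fun N => isL2Kernel_stepGraphon (W N)) hcut hnorm
  set R : ℕ → ℝ := fun N =>
    graphonNorm fun x y => stepGraphon (W N) ((φ N).1 x) ((φ N).1 y) - w x y
  obtain ⟨ρ, hρ, hρ1⟩ := exists_between hsmall
  lift ρ to ℝ≥0 using (mul_nonneg (norm_nonneg _) (Real.sqrt_nonneg _)).trans hρ.le
  have hop := hw.eventually_norm_toCLM_mul_le (fun N => isL2Kernel_stepGraphon (W N)) hφ
    (Real.sqrt_nonneg cz) hρ
  set ε : ℕ → ℝ := fun N =>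
    √(2 * |lJt| / lc * ((2 * √(∫ t, t ^ 2 ∂μ₀) + 2 * c₀) / (1 - ρ)) *
      (graphonNorm (stepGraphon (W N)) / √N))
  have hε : Tendsto ε atTop (𝓝 0) := by
    have hsqrt := Real.tendsto_sqrt_atTop.comp (tendsto_natCast_atTop_atTop (R := ℝ))
    simpa using ((hnorm.div_atTop hsqrt).const_mul _).sqrt
  have hbound : Tendsto (fun N => ε N + κ * ((R N * c₀ + ‖hw.toCLM‖ * (√cα * ε N)) / (1 - θ)))
      atTop (𝓝 0) := by
    simpa using hε.add (((hφ.mul_const c₀).add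
      ((hε.const_mul √cα).const_mul ‖hw.toCLM‖)).div_const (1 - (θ : ℝ)) |>.const_mul (κ : ℝ))
  refine squeeze_zero' (.of_forall fun _ => distS_nonneg _ _) ?_ hbound
  filter_upwards [hα, hop, eventually_gt_atTop 0] with N hnash hρN hN
  obtain ⟨zbar, hzbar⟩ := exists_isMeanAggregate hb hnash.1 hρN hρ1
  have hεN := hnash.norm_stepLp_sub_bestReply_le hμ₀ (hlaw N) (hind N) hb hb_bdd hf hJt hJ ha
    hρN hρ1 hzbar
  refine (hzbar.distS_stepFun_le hN hnash.1 hb hb_bdd (fun s => (ha s).1) haL hfb hw hcontr hzhat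
    (φ N)).trans ?_
  have hθ : (0 : ℝ) ≤ 1 - θ := sub_nonneg.2 hcontr.1.le
  gcongr

end Convergence

end GraphonGame

end

open GraphonGame in
theorem mainTheorem1_general {A : Set ℝ} (hA_nonempty : A.Nonempty) (hA_closed : IsClosed A)
    {b : ℝ → ℝ → ℝ} {f : ℝ → ℝ → ℝ → ℝ} {μ₀ : Measure ℝ} {cα cz c₀ lc lJ lJt : ℝ}
    (hμ₀ : CenteredSquareIntegrable μ₀) (hb : LipschitzDrift A b cα cz)
    (hb_bdd : BoundedDrift A b c₀) (hf : CostIntegrable A b f μ₀)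
    (hJt : CostLawLipschitz A b f μ₀ lJt) (hJ : CostRegular A b f μ₀ lc lJ)
    {Ω : ℕ → Type*} [∀ N, MeasurableSpace (Ω N)] {P : ∀ N, Measure (Ω N)}
    [∀ N, IsProbabilityMeasure (P N)] {ξ : ∀ N, Fin N → Ω N → ℝ}
    (hξ_law : ∀ N i, HasLaw (ξ N i) μ₀ (P N))
    (hξ_indep : ∀ N, Pairwise fun i j => IndepFun (ξ N i) (ξ N j) (P N))
    {W : ∀ N, Matrix (Fin N) (Fin N) ℝ} {αstar : ∀ N, Fin N → ℝ}
    (hαstar : ∀ᶠ N in atTop, IsNash A b f (P N) (ξ N) (W N) (αstar N))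
    {w : I → I → ℝ} (hw : IsL2Kernel w)
    (h_cut : Tendsto (fun N => cutDist (stepGraphon (W N)) w) atTop (𝓝 0))
    (h_norm : Tendsto (fun N => graphonNorm (stepGraphon (W N))) atTop (𝓝 (graphonNorm w)))
    (h_small_op : √cz * graphonOpNorm w < 1)
    (h_contr : lJ / lc * (√cα * graphonOpNorm w / (1 - √cz * graphonOpNorm w)) < 1) :
    ∃ αhat : Lp ℝ 2 (volume : Measure I),
      (IsGraphonNash A b f μ₀ w αhat ∧ ∀ α, IsGraphonNash A b f μ₀ w α → α = αhat) ∧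
      Tendsto (fun N => distS (stepFun (αstar N)) αhat) atTop (𝓝 0) := by
  obtain ⟨a, ha⟩ := hJ.exists_isBestReply hA_nonempty hA_closed
  have haL := hJ.lipschitzWith_bestReply ha
  have hfb := hb.lipschitzWith_feedback (fun z => (ha z).1) haL
  have hsmall : ‖hw.toCLM‖ * √cz < 1 :=
    (mul_le_mul_of_nonneg_right hw.norm_toCLM_le_graphonOpNorm (Real.sqrt_nonneg _)).trans_lt
      (mul_comm √cz _ ▸ h_small_op)
  have hκ : 0 ≤ lJ / lc := div_nonneg (hJ.lJ_nonneg hA_nonempty) hJ.1.le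
  have hcontr := hw.contractingWith_feedback hfb
    (by simpa only [Real.coe_toNNReal _ (Real.sqrt_nonneg _)] using h_small_op)
    (by simpa only [Real.coe_toNNReal _ (Real.sqrt_nonneg _), Real.coe_toNNReal _ hκ] using h_contr)
  set zhat := hcontr.fixedPoint
  have hnash := fun α => isGraphonNash_iff hb hb_bdd hA_closed hJ hw hsmall ha haL hfb (α := α)
  refine ⟨compLipschitz haL zhat, ⟨(hnash _).2 ⟨zhat, hcontr.fixedPoint_isFixedPt, rfl⟩, ?_⟩,
    tendsto_distS_stepFun hμ₀ hb hb_bdd hf hJt hJ hξ_law hξ_indep hαstar hw h_cut h_norm hsmall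
      ha haL hfb hcontr hcontr.fixedPoint_isFixedPt⟩
  intro α hα
  obtain ⟨z, hz, rfl⟩ := (hnash α).1 hα
  rw [hcontr.fixedPoint_unique hz]

theorem mainTheorem1
    -- the data of the game
    (A : Set ℝ) (hA_nonempty : A.Nonempty) (hA_closed : IsClosed A) (hA_convex : Convex ℝ A)
    (b : ℝ → ℝ → ℝ) (f : ℝ → ℝ → ℝ → ℝ)
    (μ₀ : Measure ℝ) [IsProbabilityMeasure μ₀]
    (cα cz c₀ lc lJ lJt : ℝ)
    (hμ₀ : GraphonGame.CenteredSquareIntegrable μ₀)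
    (hb : GraphonGame.LipschitzDrift A b cα cz)
    (hb_bdd : GraphonGame.BoundedDrift A b c₀)
    (hf : GraphonGame.CostIntegrable A b f μ₀)
    (hJt : GraphonGame.CostLawLipschitz A b f μ₀ lJt)
    (hJ : GraphonGame.CostRegular A b f μ₀ lc lJ)
    -- the shocks of the `N`-player games
    (Ω : ℕ → Type*) [∀ N, MeasurableSpace (Ω N)]
    (P : ∀ N, Measure (Ω N)) [∀ N, IsProbabilityMeasure (P N)]
    (ξ : ∀ N, Fin N → Ω N → ℝ)
    (hξ_law : ∀ N i, HasLaw (ξ N i) μ₀ (P N))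
    (hξ_indep : ∀ N, iIndepFun (ξ N) (P N))
    -- the interaction matrices and the unique equilibria of the `N`-player games
    (W : ∀ N, Matrix (Fin N) (Fin N) ℝ) (hW : ∀ N, (W N).IsSymm)
    (αstar : ∀ N, Fin N → ℝ)
    (hαstar : ∀ᶠ N in atTop, GraphonGame.IsNash A b f (P N) (ξ N) (W N) (αstar N) ∧
      ∀ α, GraphonGame.IsNash A b f (P N) (ξ N) (W N) α → α = αstar N)
    -- the limiting graphon
    (w : I → I → ℝ) (hw : GraphonGame.IsGraphon w)
    (h_cut : Tendsto (fun N => GraphonGame.cutDist (GraphonGame.stepGraphon (W N)) w)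
      atTop (𝓝 0))
    (h_norm : Tendsto (fun N => GraphonGame.graphonNorm (GraphonGame.stepGraphon (W N)))
      atTop (𝓝 (GraphonGame.graphonNorm w)))
    (h_op : Tendsto (fun N => GraphonGame.graphonOpNorm (GraphonGame.stepGraphon (W N)))
      atTop (𝓝 (GraphonGame.graphonOpNorm w)))
    (h_small : √(2 * cz) * GraphonGame.graphonNorm w < 1)
    (h_small_op : √cz * GraphonGame.graphonOpNorm w < 1)
    (h_contr : lJ / lc * (√cα * GraphonGame.graphonOpNorm w /
      (1 - √cz * GraphonGame.graphonOpNorm w)) < 1) :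
    ∃ αhat : Lp ℝ 2 (volume : Measure I),
      (GraphonGame.IsGraphonNash A b f μ₀ w αhat ∧
        ∀ α, GraphonGame.IsGraphonNash A b f μ₀ w α → α = αhat) ∧
      Tendsto (fun N => GraphonGame.distS (GraphonGame.stepFun (αstar N)) αhat)
        atTop (𝓝 0) :=
  mainTheorem1_general hA_nonempty hA_closed hμ₀ hb hb_bdd hf hJt hJ hξ_law
    (fun N _ _ hij => (hξ_indep N).indepFun hij) (hαstar.mono fun _ h => h.1) hw.isL2Kernel
    h_cut h_norm h_small_op h_contr
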